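/- Setting. Let $n$ agents have states $x_i(t)\in\mathbb{R}^m$, $i=1,\dots,n$. Each agent $i$ has a differentiable convex function $f_i:\mathbb{R}^m\to\mathbb{R}$ and a closed convex set $H_i\subseteq\mathbb{R}^m$. Put $X_i=\{s\in\mathbb{R}^m: \nabla f_i(s)=0\}$ and $H=\bigcap_{i=1}^n H_i$, and for a nonempty closed convex set $K$ let $P_K(s)$ denote the point of $K$ nearest to $s$. At each time $t\ge 0$ the agents communicate over a weighted directed graph $\mathcal{G}(t)$ without self-loops, with adjacency matrix $[a_{ij}(t)]$: there is a constant $\eta>0$, independent of $t$, such that $a_{ij}(t)\ge\eta$ if $(j,i)$ is an edge of $\mathcal{G}(t)$ (agent $i$ receives information from agent $j$) and $a_{ij}(t)=0$ otherwise. Let $N_i(t)=\{j:(j,i)\text{ is an edge of }\mathcal{G}(t)\}$. Consider the algorithm $$\dot q_i(t)=\arctan\bigl(e^{\|x_i(t)\|}\bigr),\qquad q_i(0)>0,$$ $$\dot x_i(t)=\sum_{j\in N_i(t)}a_{ij}(t)\bigl(x_j(t)-x_i(t)\bigr)-\bigl[x_i(t)-P_{H_i}(x_i(t))\bigr]-\frac{\nabla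 f_i(x_i(t))}{\sqrt{q_i(t)}},\qquad i=1,\dots,n,$$ where the $x_i$ are continuous on $[0,\infty)$ and satisfy the second equation at all times between switching times of the graph. Let $x^*(t)=\frac1n\sum_{i=1}^n x_i(t)$. Assume: (a) each $X_i$ is nonempty and bounded; (b) $H\neq\emptyset$; (c) $\mathcal{G}(t)$ is balanced for all $t\ge0$, i.e. $\sum_{j}a_{ij}(t)=\sum_{j}a_{ji}(t)$ for every $i$; (d) there are switching times $0=\sigma_0<\sigma_1<\sigma_2<\cdots$ and a dwell time $d_w>0$ such that $\sigma_{k+1}-\sigma_k\ge d_w$ for all $k$ and $\mathcal{G}(t)$, including its weights, is constant on each $[\sigma_k,\sigma_{k+1})$; (e) there are a constant $M>d_w$ and an infinite sequence $0=t_0<t_1<t_2<\cdots$ of these switching times with $t_{j+1}-t_j\le M$ such that, for every $j\ge 0$, the union of the graphs $\mathcal{G}(t)$ over $t\in[t_j,t_{j+1})$ is strongly connected. Theorem. For arbitrary initial conditions $x_i(0)\in\mathbb{R}^m$ and $q_i(0)>0$, every solution of the algorithm on $[0,\infty)$ satisfies: (1) all $x_i(t)$, $i=1,\dots,n$, $t\ge0$,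 remain in a bounded region of $\mathbb{R}^m$; (2) $\lim_{t\to+\infty}\|x^*(t)-P_H(x^*(t))\|=0$ and $\lim_{t\to+\infty}[x_i(t)-x^*(t)]=0$ for all $i$. -/

import Mathlib

open Set Filter Topology

/-- A weighted directed communication graph on the agents `Fin n`, with the lower bound `η` on the
weights of its edges. `Adj j i` is the edge `(j, i)`: agent `i` obtains information from `j`, and
the weight of that edge is the entry `A i j` of the adjacency matrix. -/
structure CommGraph (n : ℕ) (η : ℝ) where
  /-- the directed graph of the edges -/
  toDigraph : Digraph (Fin n)
  /-- the weighted adjacency matrix -/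
  A : Matrix (Fin n) (Fin n) ℝ
  no_loop : ∀ i, ¬ toDigraph.Adj i i
  le_weight : ∀ i j, toDigraph.Adj j i → η ≤ A i j
  weight_eq_zero : ∀ i j, ¬ toDigraph.Adj j i → A i j = 0

namespace CommGraph

variable {n : ℕ} {η : ℝ}

/-- The graph is balanced: at every agent the row sum and the column sum of the weights agree. -/
def Balanced (G : CommGraph n η) : Prop :=
  ∀ i, ∑ j, G.A i j = ∑ j, G.A j i

open Classical in
/-- The set `N_i = {j | (j, i) is an edge}` of neighbors of agent `i`. -/
noncomputable def neighbors (G : CommGraph n η) (i : Fin n) : Finset (Fin n) :=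
  Finset.univ.filter fun j => G.toDigraph.Adj j i

/-- The union of the graphs `G t`, `t ∈ T`. -/
def union (G : ℝ → CommGraph n η) (T : Set ℝ) : Digraph (Fin n) where
  Adj i j := ∃ t ∈ T, (G t).toDigraph.Adj i j

end CommGraph

/-- Every vertex is joined to every other vertex by a directed path. -/
def Digraph.StronglyConnected {V : Type*} (D : Digraph V) : Prop :=
  ∀ i j : V, i ≠ j → Relation.TransGen D.Adj i j

/-- `σ 0 = 0 < σ 1 < σ 2 < ⋯` are switching times of the graph `G`, with dwell time `dw`: two
contiguous ones are at least `dw` apart, and `G` (edges and weights) is constant in between. -/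
structure IsSwitchingSeq {n : ℕ} {η : ℝ} (G : ℝ → CommGraph n η) (dw : ℝ) (σ : ℕ → ℝ) : Prop where
  zero : σ 0 = 0
  dwell : ∀ k, dw ≤ σ (k + 1) - σ k
  const : ∀ k, ∀ t ∈ Ico (σ k) (σ (k + 1)), G t = G (σ k)

/-- Joint strong connectivity with bound `M`: among the switching times `σ` there is an infinite
sequence `0 = t₀ < t₁ < ⋯`, `t_j = σ (κ j)`, with gaps at most `M`, such that for every `j` the
union of the graphs over `[t_j, t_{j+1})` is strongly connected. -/
def JointlyStronglyConnected {n : ℕ} {η : ℝ} (G : ℝ → CommGraph n η) (σ : ℕ → ℝ) (M : ℝ) : Prop :=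
  ∃ κ : ℕ → ℕ, StrictMono κ ∧ κ 0 = 0 ∧
    ∀ j, σ (κ (j + 1)) - σ (κ j) ≤ M ∧
      (CommGraph.union G (Ico (σ (κ j)) (σ (κ (j + 1))))).StronglyConnected

section Projection

variable {E : Type*} [NormedAddCommGroup E] [InnerProductSpace ℝ E]

open Classical in
/-- The projection `P_K(x)`: the point of `K` nearest to `x`. It exists and is unique when `K` is
nonempty, closed and convex and `E` is complete; the value is `x` if there is no nearest point. -/
noncomputable def proj (K : Set E) (x : E) : E :=
  if h : ∃ y ∈ K, ∀ z ∈ K, ‖x - y‖ ≤ ‖x - z‖ then h.choose else x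

/-- On nonempty closed convex sets `proj` is the nearest point. -/
theorem proj_spec [CompleteSpace E] {K : Set E} (hne : K.Nonempty) (hc : IsClosed K)
    (hK : Convex ℝ K) (x : E) : proj K x ∈ K ∧ ∀ z ∈ K, ‖x - proj K x‖ ≤ ‖x - z‖ := by
  have h : ∃ y ∈ K, ∀ z ∈ K, ‖x - y‖ ≤ ‖x - z‖ := by
    obtain ⟨y, hy, he⟩ := exists_norm_eq_iInf_of_complete_convex hne hc.isComplete hK x
    refine ⟨y, hy, fun z hz => ?_⟩
    rw [he]
    exact ciInf_le (f := fun w : K => ‖x - w‖)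
      ⟨0, by rintro _ ⟨w, rfl⟩; exact norm_nonneg _⟩ ⟨z, hz⟩
  rw [proj, dif_pos h]
  exact h.choose_spec

end Projection

/-- `(x, q)` is a solution on `[0, ∞)` of the closed-loop system: for every agent `i`
* `q_i' = arctan (exp ‖x_i‖)` with `q_i(0) > 0`,
* `x_i` is continuous on `[0, ∞)` and between contiguous switching times
  `x_i' = ∑_{j ∈ N_i(t)} a_ij(t) (x_j - x_i) - (x_i - P_{H_i}(x_i)) - ∇f_i(x_i) / √q_i`. -/
structure IsSolution {n m : ℕ} {η : ℝ} (G : ℝ → CommGraph n η) (σ : ℕ → ℝ)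
    (f : Fin n → EuclideanSpace ℝ (Fin m) → ℝ) (H : Fin n → Set (EuclideanSpace ℝ (Fin m)))
    (x : Fin n → ℝ → EuclideanSpace ℝ (Fin m)) (q : Fin n → ℝ → ℝ) : Prop where
  q_init : ∀ i, 0 < q i 0
  q_deriv : ∀ i, ∀ t, 0 ≤ t →
    HasDerivWithinAt (q i) (Real.arctan (Real.exp ‖x i t‖)) (Ici 0) t
  x_cont : ∀ i, ContinuousOn (x i) (Ici 0)
  x_deriv : ∀ i, ∀ k, ∀ t ∈ Ioo (σ k) (σ (k + 1)),
    HasDerivAt (x i)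
      (∑ j ∈ (G t).neighbors i, (G t).A i j • (x j t - x i t)
        - (x i t - proj (H i) (x i t))
        - (1 / √(q i t)) • gradient (f i) (x i t)) t

/-- The average `x^*(t) = (1/n) ∑_i x_i(t)` of the agent states. -/
noncomputable def avg {n m : ℕ} (x : Fin n → ℝ → EuclideanSpace ℝ (Fin m)) (t : ℝ) :
    EuclideanSpace ℝ (Fin m) :=
  (1 / (n : ℝ)) • ∑ i, x i t

/-! The gradient terms act as a vanishing perturbation. Since arctan(e^‖x‖) lies in [π/4, π/2),
every q_i grows linearly, so the gains 1/√q_i tend to 0 while staying within a fixed ratio of each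
other. This ratio and the coercivity of the f_i make ½∑‖x_i - z‖², z ∈ H, nonincreasing wherever it
is large (`IsSolution.exists_norm_le`). Bounded states have bounded gradients, so what remains is
`IsFlow`: switched consensus plus projections plus a perturbation g → 0.

Two functions are followed: W = `sumSqDist`, the squared distance to H, and S = `dispersion`. With E
the Dirichlet energy and d_i the distance of x_i to H_i, W' ≤ -∑ d_i² + O(‖g‖) and S' ≤ -E + O(∑
(d_i + ‖g_i‖)).

The weights have no upper bound, so displacements cannot be estimated through the size of the
Laplacian. The sector inequality `lapForm_le`, obtained from Birkhoff's theorem, bounds the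
Laplacian form by energies with a constant depending on n only. Displacements are then controlled by
∫E and the forcing, edges active at different times of a window can be compared at its start, and S
contracts over each strongly connected window up to the forcing (`IsFlow.dispersion_contraction`).

The distances d_i enter S' to first order but are dissipated in W only to second order. By Young's
inequality W + cS, with a small c, either drops by a fixed amount over a window or ends small
(`IsFlow.exists_window_dichotomy`); the second case uses compactness. As c depends on the target
accuracy, this yields only W → 0. But then the forcing vanishes, and the contraction gives S → 0. -/

/-! ### Dirichlet energy of a weight matrix. -/

section Energy

variable {n : ℕ} {F : Type*} [NormedAddCommGroup F]

/-- The Dirichlet energy of the weighted adjacency matrix `A`. -/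
noncomputable def dirichletEnergy (A : Matrix (Fin n) (Fin n) ℝ) (x : Fin n → F) : ℝ :=
  ∑ i, ∑ j, A i j * (‖x i - x j‖ ^ 2 / 2)

theorem dirichletEnergy_nonneg {A : Matrix (Fin n) (Fin n) ℝ} (hA : ∀ i j, 0 ≤ A i j)
    (x : Fin n → F) : 0 ≤ dirichletEnergy A x :=
  Finset.sum_nonneg fun i _ => Finset.sum_nonneg fun j _ => mul_nonneg (hA i j) (by positivity)

theorem le_dirichletEnergy {A : Matrix (Fin n) (Fin n) ℝ} (hA : ∀ i j, 0 ≤ A i j)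
    (x : Fin n → F) (i j : Fin n) : A i j * (‖x i - x j‖ ^ 2 / 2) ≤ dirichletEnergy A x := by
  have h (i j) : 0 ≤ A i j * (‖x i - x j‖ ^ 2 / 2) := mul_nonneg (hA i j) (by positivity)
  exact (Finset.single_le_sum (f := fun j => A i j * (‖x i - x j‖ ^ 2 / 2)) (fun j _ => h i j)
    (Finset.mem_univ j)).trans
    (Finset.single_le_sum (f := fun i => ∑ j, A i j * (‖x i - x j‖ ^ 2 / 2))
      (fun i _ => Finset.sum_nonneg fun j _ => h i j) (Finset.mem_univ i))

theorem dirichletEnergy_neg (A : Matrix (Fin n) (Fin n) ℝ) (p : Fin n → F) :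
    dirichletEnergy A (fun i => - p i) = dirichletEnergy A p := by
  simp only [dirichletEnergy, neg_sub_neg]
  simp only [norm_sub_rev]

theorem dirichletEnergy_sum_smul {ι : Type*} (s : Finset ι) (w : ι → ℝ)
    (B : ι → Matrix (Fin n) (Fin n) ℝ) (x : Fin n → F) :
    dirichletEnergy (∑ k ∈ s, w k • B k) x = ∑ k ∈ s, w k * dirichletEnergy (B k) x := by
  simp only [dirichletEnergy, Matrix.sum_apply, Matrix.smul_apply, smul_eq_mul, Finset.sum_mul,
    Finset.mul_sum, mul_assoc]
  rw [Finset.sum_comm]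
  conv_lhs => enter [2, j]; rw [Finset.sum_comm]
  rw [Finset.sum_comm]
  refine Finset.sum_congr rfl fun k _ => Finset.sum_comm

theorem dirichletEnergy_congr {A B : Matrix (Fin n) (Fin n) ℝ} {d : ℝ}
    (h : ∀ i j, i ≠ j → A i j = d * B i j) (x : Fin n → F) :
    dirichletEnergy A x = d * dirichletEnergy B x := by
  simp only [dirichletEnergy, Finset.mul_sum]
  refine Finset.sum_congr rfl fun i _ => Finset.sum_congr rfl fun j _ => ?_
  by_cases hij : i = j
  · simp [hij]
  · rw [h i j hij, mul_assoc]

/-- Walk from i to π^k i one π-step at a time; each step costs a factor 2 from ‖u + v‖² ≤ 2‖u‖² +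
2‖v‖², and π only permutes the summands. -/
theorem sum_norm_perm_pow_sub_sq_le (π : Equiv.Perm (Fin n)) (p : Fin n → F) (k : ℕ) :
    ∑ i, ‖p i - p ((π ^ k) i)‖ ^ 2 ≤ 4 ^ k * ∑ i, ‖p i - p (π i)‖ ^ 2 := by
  have hQ : 0 ≤ ∑ i, ‖p i - p (π i)‖ ^ 2 := by positivity
  induction k with
  | zero => simpa using hQ
  | succ k ih =>
    have h1 : ∑ i, ‖p i - p ((π ^ (k + 1)) i)‖ ^ 2
        ≤ ∑ i, (2 * ‖p i - p (π i)‖ ^ 2 + 2 * ‖p (π i) - p ((π ^ k) (π i))‖ ^ 2) := by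
      refine Finset.sum_le_sum fun i _ => ?_
      have h2 : p i - p ((π ^ (k + 1)) i) = (p i - p (π i)) + (p (π i) - p ((π ^ k) (π i))) := by
        rw [pow_succ, Equiv.Perm.mul_apply]; abel
      rw [h2]
      have := norm_add_le (p i - p (π i)) (p (π i) - p ((π ^ k) (π i)))
      nlinarith [sq_nonneg (‖p i - p (π i)‖ - ‖p (π i) - p ((π ^ k) (π i))‖),
        norm_nonneg ((p i - p (π i)) + (p (π i) - p ((π ^ k) (π i))))]
    rw [Finset.sum_add_distrib, ← Finset.mul_sum, ← Finset.mul_sum,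
      Equiv.sum_comp π fun i => ‖p i - p ((π ^ k) i)‖ ^ 2] at h1
    have h3 : (1 : ℝ) ≤ 4 ^ k := one_le_pow₀ (by norm_num)
    rw [pow_succ (4 : ℝ)]
    nlinarith

end Energy

/-! ### Laplacian form and the weight-independent sector inequality. -/

section Laplacian

variable {n : ℕ} {F : Type*} [NormedAddCommGroup F] [InnerProductSpace ℝ F]

/-- The bilinear form `⟪p, L x⟫` of the Laplacian of the weighted adjacency matrix `A`. -/
noncomputable def lapForm (A : Matrix (Fin n) (Fin n) ℝ) (p x : Fin n → F) : ℝ :=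
  ∑ i, ∑ j, A i j * inner ℝ (p i) (x i - x j)

/-- For a balanced matrix, sums of differences along the edges vanish. -/
theorem sum_mul_sub_eq_zero {A : Matrix (Fin n) (Fin n) ℝ} (hb : ∀ i, ∑ j, A i j = ∑ j, A j i)
    (w : Fin n → ℝ) : ∑ i, ∑ j, A i j * (w i - w j) = 0 := by
  have h1 : ∑ i, ∑ j, A i j * w j = ∑ i, ∑ j, A j i * w i := Finset.sum_comm
  simp only [mul_sub, Finset.sum_sub_distrib, h1]
  simp only [← Finset.sum_mul, hb, sub_self]

theorem lapForm_const {A : Matrix (Fin n) (Fin n) ℝ} (hb : ∀ i, ∑ j, A i j = ∑ j, A j i)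
    (z : F) (x : Fin n → F) : lapForm A (fun _ => z) x = 0 := by
  simp only [lapForm, inner_sub_right]
  exact sum_mul_sub_eq_zero hb fun i => inner ℝ z (x i)

theorem lapForm_sub_left (A : Matrix (Fin n) (Fin n) ℝ) (p p' x : Fin n → F) :
    lapForm A (fun i => p i - p' i) x = lapForm A p x - lapForm A p' x := by
  simp only [lapForm, inner_sub_left, mul_sub, Finset.sum_sub_distrib]

theorem lapForm_neg_left (A : Matrix (Fin n) (Fin n) ℝ) (p x : Fin n → F) :
    lapForm A (fun i => - p i) x = - lapForm A p x := by
  simp only [lapForm, inner_neg_left, mul_neg, Finset.sum_neg_distrib]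

theorem lapForm_self {A : Matrix (Fin n) (Fin n) ℝ} (hb : ∀ i, ∑ j, A i j = ∑ j, A j i)
    (x : Fin n → F) : lapForm A x x = dirichletEnergy A x := by
  rw [← sub_eq_zero, lapForm, dirichletEnergy, ← Finset.sum_sub_distrib,
    ← sum_mul_sub_eq_zero hb fun i => ‖x i‖ ^ 2 / 2]
  refine Finset.sum_congr rfl fun i _ => ?_
  rw [← Finset.sum_sub_distrib]
  refine Finset.sum_congr rfl fun j _ => ?_
  rw [norm_sub_sq_real, inner_sub_right, real_inner_self_eq_norm_sq]
  ring

theorem lapForm_sub_const {A : Matrix (Fin n) (Fin n) ℝ} (hb : ∀ i, ∑ j, A i j = ∑ j, A j i)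
    (z : F) (x : Fin n → F) : lapForm A (fun i => x i - z) x = dirichletEnergy A x := by
  rw [lapForm_sub_left A x (fun _ => z), lapForm_const hb, lapForm_self hb, sub_zero]

/-- Averaging p over the powers of π gives a π-invariant family, whose pairing with x - x ∘ π
vanishes. So p may be replaced by its deviation from the average, and that is controlled by the
energy of p. -/
theorem sum_inner_sub_perm_le (π : Equiv.Perm (Fin n)) (p x : Fin n → F) {N : ℕ} (hN : 0 < N)
    (hπ : π ^ N = 1) :
    ∑ i, inner ℝ (p i) (x i - x (π i))
      ≤ 4 ^ N * (∑ i, ‖p i - p (π i)‖ ^ 2 / 2 + ∑ i, ‖x i - x (π i)‖ ^ 2 / 2) := by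
  set P := ∑ i, ‖p i - p (π i)‖ ^ 2 / 2 with hP
  set X := ∑ i, ‖x i - x (π i)‖ ^ 2 / 2 with hX
  have hP0 : 0 ≤ P := by positivity
  have hX0 : 0 ≤ X := by positivity
  -- After reindexing by (π^k)⁻¹ the sum over k telescopes cyclically; it closes up because π^N = 1.
  have h0 : ∑ k ∈ Finset.range N, ∑ i, inner ℝ (p ((π ^ k) i)) (x i - x (π i)) = 0 := by
    have h1 (k : ℕ) : ∑ i, inner ℝ (p ((π ^ k) i)) (x i - x (π i))
        = ∑ i, inner ℝ (p i) (x ((π ^ k)⁻¹ i)) - ∑ i, inner ℝ (p i) (x ((π ^ k)⁻¹ (π i))) := by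
      rw [← Finset.sum_sub_distrib,
        ← Equiv.sum_comp (π ^ k)⁻¹ fun i => inner ℝ (p ((π ^ k) i)) (x i - x (π i))]
      refine Finset.sum_congr rfl fun i _ => ?_
      have : π ((π ^ k)⁻¹ i) = (π ^ k)⁻¹ (π i) := by
        rw [← Equiv.Perm.mul_apply, ← Equiv.Perm.mul_apply,
          ((Commute.refl π).pow_right k).inv_right.eq]
      rw [this, inner_sub_right, show (π ^ k) ((π ^ k)⁻¹ i) = i from (π ^ k).apply_symm_apply i]
    have h2 (k : ℕ) : ∑ i, inner ℝ (p i) (x ((π ^ (k + 1))⁻¹ (π i)))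
        = ∑ i, inner ℝ (p i) (x ((π ^ k)⁻¹ i)) := by
      refine Finset.sum_congr rfl fun i _ => ?_
      rw [pow_succ', mul_inv_rev]; simp
    have h3 : ∑ k ∈ Finset.range N, ∑ i, inner ℝ (p i) (x ((π ^ k)⁻¹ (π i)))
        = ∑ k ∈ Finset.range N, ∑ i, inner ℝ (p i) (x ((π ^ k)⁻¹ i)) := by
      obtain ⟨M, rfl⟩ : ∃ M, N = M + 1 := ⟨N - 1, by omega⟩
      rw [Finset.sum_range_succ', Finset.sum_range_succ (n := M)]
      simp only [h2]
      congr 1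
      have := h2 M
      rw [hπ] at this
      simpa using this
    simp only [h1, Finset.sum_sub_distrib, h3, sub_self]
  have h1 : ∀ k ∈ Finset.range N, ∑ i, inner ℝ (p i) (x i - x (π i))
      - ∑ i, inner ℝ (p ((π ^ k) i)) (x i - x (π i)) ≤ 4 ^ N * (P + X) := by
    intro k hk
    have h2 : ∑ i, inner ℝ (p i) (x i - x (π i)) - ∑ i, inner ℝ (p ((π ^ k) i)) (x i - x (π i))
        ≤ ∑ i, (‖p i - p ((π ^ k) i)‖ ^ 2 / 2 + ‖x i - x (π i)‖ ^ 2 / 2) := by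
      rw [← Finset.sum_sub_distrib]
      refine Finset.sum_le_sum fun i _ => ?_
      rw [← inner_sub_left]
      have := real_inner_le_norm (p i - p ((π ^ k) i)) (x i - x (π i))
      nlinarith [sq_nonneg (‖p i - p ((π ^ k) i)‖ - ‖x i - x (π i)‖)]
    have h3 := sum_norm_perm_pow_sub_sq_le π p k
    rw [Finset.sum_add_distrib, ← hX, ← Finset.sum_div] at h2
    rw [← Finset.sum_div] at hP
    have h4 : (4 : ℝ) ^ k ≤ 4 ^ N := pow_le_pow_right₀ (by norm_num) (Finset.mem_range.1 hk).le
    have h5 : (1 : ℝ) ≤ 4 ^ N := one_le_pow₀ (by norm_num)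
    nlinarith
  have h2 := Finset.sum_le_sum h1
  rw [Finset.sum_sub_distrib, h0] at h2
  simp only [Finset.sum_const, Finset.card_range, nsmul_eq_mul, sub_zero] at h2
  exact le_of_mul_le_mul_left h2 (by exact_mod_cast hN)

/-- The constant in the sector inequality `lapForm_le`. -/
noncomputable def sectorConst (n : ℕ) : ℝ := 4 ^ n.factorial

theorem sectorConst_nonneg (n : ℕ) : 0 ≤ sectorConst n := by unfold sectorConst; positivity

theorem lapForm_sum_smul {ι : Type*} (s : Finset ι) (w : ι → ℝ)
    (B : ι → Matrix (Fin n) (Fin n) ℝ) (p x : Fin n → F) :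
    lapForm (∑ k ∈ s, w k • B k) p x = ∑ k ∈ s, w k * lapForm (B k) p x := by
  simp only [lapForm, Matrix.sum_apply, Matrix.smul_apply, smul_eq_mul, Finset.sum_mul,
    Finset.mul_sum, mul_assoc]
  rw [Finset.sum_comm]
  conv_lhs => enter [2, j]; rw [Finset.sum_comm]
  rw [Finset.sum_comm]
  refine Finset.sum_congr rfl fun k _ => Finset.sum_comm

/-- By Birkhoff's theorem B is a convex combination of permutation matrices, and both sides are
linear in B. The exponent n! in `sectorConst` serves all permutations at once, since π^(n!) = 1. -/
theorem lapForm_le_of_doublyStochastic {B : Matrix (Fin n) (Fin n) ℝ}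
    (hB : B ∈ doublyStochastic ℝ (Fin n)) (p x : Fin n → F) :
    lapForm B p x ≤ sectorConst n * (dirichletEnergy B p + dirichletEnergy B x) := by
  obtain ⟨w, hw, -, rfl⟩ := exists_eq_sum_perm_of_mem_doublyStochastic hB
  rw [lapForm_sum_smul, dirichletEnergy_sum_smul, dirichletEnergy_sum_smul,
    ← Finset.sum_add_distrib, Finset.mul_sum]
  refine Finset.sum_le_sum fun π _ => ?_
  rw [← mul_add, mul_left_comm]
  refine mul_le_mul_of_nonneg_left ?_ (hw π)
  have := sum_inner_sub_perm_le π p x n.factorial_pos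
    (by simpa [Fintype.card_perm] using pow_card_eq_one (x := π))
  simpa [lapForm, dirichletEnergy, sectorConst, Equiv.Perm.permMatrix, PEquiv.toMatrix_apply,
    ite_mul] using this

theorem lapForm_congr {A B : Matrix (Fin n) (Fin n) ℝ} {d : ℝ}
    (h : ∀ i j, i ≠ j → A i j = d * B i j) (p x : Fin n → F) :
    lapForm A p x = d * lapForm B p x := by
  simp only [lapForm, Finset.mul_sum]
  refine Finset.sum_congr rfl fun i _ => Finset.sum_congr rfl fun j _ => ?_
  by_cases hij : i = j
  · simp [hij]
  · rw [h i j hij, mul_assoc]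

/-- Off the diagonal, a balanced nonnegative matrix is a multiple of a doubly stochastic one. -/
theorem exists_doublyStochastic_of_balanced {A : Matrix (Fin n) (Fin n) ℝ} (hA : ∀ i j, 0 ≤ A i j)
    (hb : ∀ i, ∑ j, A i j = ∑ j, A j i) :
    ∃ d : ℝ, 0 ≤ d ∧ ∃ B ∈ doublyStochastic ℝ (Fin n), ∀ i j, i ≠ j → A i j = d * B i j := by
  set T := ∑ i, ∑ j, A i j with hT
  have hrow (i) : 0 ≤ ∑ j, A i j := Finset.sum_nonneg fun j _ => hA i j
  have hT0 : 0 ≤ T := Finset.sum_nonneg fun i _ => hrow i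
  have hd : (0 : ℝ) < T + 1 := by linarith
  have hle (i) : ∑ j, A i j ≤ T :=
    Finset.single_le_sum (f := fun i => ∑ j, A i j) (fun i _ => hrow i) (Finset.mem_univ i)
  -- The diagonal is invisible to both forms, so it is filled until every row sums to T + 1, T being
  -- the total weight; balance then gives the columns the same sum. The extra 1 keeps the divisor
  -- positive when A = 0.
  refine ⟨T + 1, hd.le,
    (T + 1)⁻¹ • (A + Matrix.diagonal fun i => T + 1 - ∑ j, A i j), ?_, fun i j hij => ?_⟩
  · rw [mem_doublyStochastic_iff_sum]
    refine ⟨fun i j => ?_, fun i => ?_, fun j => ?_⟩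
    · rw [Matrix.smul_apply, Matrix.add_apply, smul_eq_mul]
      refine mul_nonneg (by positivity) (add_nonneg (hA i j) ?_)
      rw [Matrix.diagonal_apply]
      split_ifs
      · linarith [hle i]
      · exact le_rfl
    · simp only [Matrix.smul_apply, Matrix.add_apply, smul_eq_mul, ← Finset.mul_sum,
        Finset.sum_add_distrib, Matrix.diagonal_apply, Finset.sum_ite_eq, Finset.mem_univ, if_true]
      field_simp
      ring
    · simp only [Matrix.smul_apply, Matrix.add_apply, smul_eq_mul, ← Finset.mul_sum,
        Finset.sum_add_distrib, Matrix.diagonal_apply, Finset.sum_ite_eq', Finset.mem_univ, if_true]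
      rw [hb j]
      field_simp
      ring
  · simp [Matrix.diagonal_apply_ne _ hij, hd.ne']

/-- Sector inequality: the Laplacian of a balanced graph is controlled by its energy, with a
constant that does not depend on the weights. -/
theorem lapForm_le {A : Matrix (Fin n) (Fin n) ℝ} (hA : ∀ i j, 0 ≤ A i j)
    (hb : ∀ i, ∑ j, A i j = ∑ j, A j i) (p x : Fin n → F) :
    lapForm A p x ≤ sectorConst n * (dirichletEnergy A p + dirichletEnergy A x) := by
  obtain ⟨d, hd, B, hB, h⟩ := exists_doublyStochastic_of_balanced hA hb
  rw [lapForm_congr h, dirichletEnergy_congr h, dirichletEnergy_congr h, ← mul_add, mul_left_comm]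
  exact mul_le_mul_of_nonneg_left (lapForm_le_of_doublyStochastic hB p x) hd

theorem abs_lapForm_le {A : Matrix (Fin n) (Fin n) ℝ} (hA : ∀ i j, 0 ≤ A i j)
    (hb : ∀ i, ∑ j, A i j = ∑ j, A j i) (p x : Fin n → F) :
    |lapForm A p x| ≤ sectorConst n * (dirichletEnergy A p + dirichletEnergy A x) := by
  rw [abs_le']
  refine ⟨lapForm_le hA hb p x, ?_⟩
  rw [← lapForm_neg_left, ← dirichletEnergy_neg A p]
  exact lapForm_le hA hb _ x

end Laplacian

/-! ### Projections and the squared distance to a convex set. -/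

section ProjLemmas

variable {F : Type*} [NormedAddCommGroup F] [InnerProductSpace ℝ F] [CompleteSpace F] {K : Set F}

theorem norm_sub_proj_eq_infDist (hne : K.Nonempty) (hc : IsClosed K) (hK : Convex ℝ K) (x : F) :
    ‖x - proj K x‖ = Metric.infDist x K := by
  obtain ⟨h1, h2⟩ := proj_spec hne hc hK x
  refine le_antisymm ((Metric.le_infDist hne).2 fun z hz => ?_) ?_
  · rw [dist_eq_norm]; exact h2 z hz
  · rw [← dist_eq_norm]; exact Metric.infDist_le_dist_of_mem h1

theorem inner_sub_proj_le_zero (hne : K.Nonempty) (hc : IsClosed K) (hK : Convex ℝ K) (x : F)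
    {z : F} (hz : z ∈ K) : inner ℝ (x - proj K x) (z - proj K x) ≤ 0 := by
  obtain ⟨h1, h2⟩ := proj_spec hne hc hK x
  refine (norm_eq_iInf_iff_real_inner_le_zero hK h1).1 ?_ z hz
  have : Nonempty K := hne.to_subtype
  refine le_antisymm (le_ciInf fun w => h2 w w.2) ?_
  exact ciInf_le (f := fun w : K => ‖x - w‖)
    ⟨0, by rintro _ ⟨w, rfl⟩; exact norm_nonneg _⟩ ⟨proj K x, h1⟩

theorem norm_sub_proj_sq_le_inner (hne : K.Nonempty) (hc : IsClosed K) (hK : Convex ℝ K) (x : F)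
    {z : F} (hz : z ∈ K) : ‖x - proj K x‖ ^ 2 ≤ inner ℝ (x - z) (x - proj K x) := by
  have h := inner_sub_proj_le_zero hne hc hK x hz
  have h2 : x - z = (x - proj K x) - (z - proj K x) := by abel
  rw [h2, inner_sub_left, real_inner_self_eq_norm_sq, real_inner_comm (x - proj K x) (z - proj K x)]
  linarith

theorem infDist_sq_le_add_inner (hne : K.Nonempty) (hc : IsClosed K) (hK : Convex ℝ K) (x y : F) :
    Metric.infDist y K ^ 2 / 2
      ≤ Metric.infDist x K ^ 2 / 2 + inner ℝ (x - proj K x) (y - x) + ‖y - x‖ ^ 2 / 2 := by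
  have h1 : Metric.infDist y K ≤ ‖y - proj K x‖ := by
    rw [← dist_eq_norm]; exact Metric.infDist_le_dist_of_mem (proj_spec hne hc hK x).1
  rw [← norm_sub_proj_eq_infDist hne hc hK x]
  have h2 : y - proj K x = (x - proj K x) + (y - x) := by abel
  have h3 := norm_add_sq_real (x - proj K x) (y - x)
  rw [← h2] at h3
  nlinarith [Metric.infDist_nonneg (x := y) (s := K)]

theorem infDist_sq_add_inner_le (hne : K.Nonempty) (hc : IsClosed K) (hK : Convex ℝ K) (x y : F) :
    Metric.infDist x K ^ 2 / 2 + inner ℝ (x - proj K x) (y - x) ≤ Metric.infDist y K ^ 2 / 2 := by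
  have h := inner_sub_proj_le_zero hne hc hK x (proj_spec hne hc hK y).1
  rw [← norm_sub_proj_eq_infDist hne hc hK, ← norm_sub_proj_eq_infDist hne hc hK]
  have h2 : y - x = (y - proj K y) + (proj K y - proj K x) - (x - proj K x) := by abel
  have h3 := real_inner_le_norm (x - proj K x) (y - proj K y)
  rw [h2, inner_sub_right, inner_add_right, real_inner_self_eq_norm_sq]
  nlinarith [sq_nonneg (‖x - proj K x‖ - ‖y - proj K y‖)]

/-- No regularity of `proj` is used: the two preceding inequalities place the first-order remainder
between 0 and ‖y - x‖²/2. -/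
theorem hasFDerivAt_infDist_sq (hne : K.Nonempty) (hc : IsClosed K) (hK : Convex ℝ K) (x : F) :
    HasFDerivAt (fun y => Metric.infDist y K ^ 2 / 2) (innerSL ℝ (x - proj K x)) x := by
  rw [hasFDerivAt_iff_isLittleO]
  refine Asymptotics.IsBigO.trans_isLittleO (g := fun y => ‖y - x‖ ^ 2) ?_ ?_
  · refine Asymptotics.IsBigO.of_bound 1 (Eventually.of_forall fun y => ?_)
    rw [innerSL_apply_apply, Real.norm_eq_abs, Real.norm_eq_abs, abs_le,
      abs_of_nonneg (sq_nonneg _)]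
    constructor <;> nlinarith [infDist_sq_le_add_inner hne hc hK x y,
      infDist_sq_add_inner_le hne hc hK x y, sq_nonneg ‖y - x‖]
  · exact Asymptotics.isLittleO_pow_sub_sub x one_lt_two

/-- Consensus does not increase the total squared distance to K: the gradient inequality of ½dist²
bounds each edge term below by a difference of values at its ends, and over a balanced graph these
differences sum to 0. -/
theorem lapForm_sub_proj_nonneg {n : ℕ} {A : Matrix (Fin n) (Fin n) ℝ} (hA : ∀ i j, 0 ≤ A i j)
    (hb : ∀ i, ∑ j, A i j = ∑ j, A j i) (hne : K.Nonempty) (hc : IsClosed K) (hK : Convex ℝ K)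
    (x : Fin n → F) : 0 ≤ lapForm A (fun i => x i - proj K (x i)) x := by
  rw [← sum_mul_sub_eq_zero hb fun i => Metric.infDist (x i) K ^ 2 / 2]
  refine Finset.sum_le_sum fun i _ => Finset.sum_le_sum fun j _ =>
    mul_le_mul_of_nonneg_left ?_ (hA i j)
  have := infDist_sq_add_inner_le hne hc hK (x i) (x j)
  rw [← neg_sub (x i) (x j), inner_neg_right] at this
  linarith

end ProjLemmas

/-! ### Differentiable convex functions: coercivity and gradient bounds. -/

section ConvexLemmas

variable {F : Type*} [NormedAddCommGroup F] [InnerProductSpace ℝ F] [CompleteSpace F] {f : F → ℝ}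

/-- First order inequality for differentiable convex functions. -/
theorem ConvexOn.add_inner_gradient_le (hf : ConvexOn ℝ univ f) (hd : Differentiable ℝ f)
    (x y : F) : f x + inner ℝ (gradient f x) (y - x) ≤ f y := by
  have h1 : ConvexOn ℝ univ (f ∘ AffineMap.lineMap (k := ℝ) x y) := hf.comp_affineMap _
  have h2 : HasDerivAt (f ∘ AffineMap.lineMap (k := ℝ) x y) (inner ℝ (gradient f x) (y - x)) 0 := by
    have h3 : HasDerivAt (AffineMap.lineMap (k := ℝ) x y) (y - x) (0 : ℝ) :=
      AffineMap.hasDerivAt_lineMap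
    have h4 : HasFDerivAt f (InnerProductSpace.toDual ℝ F (gradient f x))
        (AffineMap.lineMap x y (0 : ℝ)) := by
      rw [AffineMap.lineMap_apply_zero]
      exact (hd x).hasGradientAt.hasFDerivAt
    simpa using h4.comp_hasDerivAt (0 : ℝ) h3
  have h5 := h1.le_slope_of_hasDerivAt (mem_univ 0) (mem_univ 1) zero_lt_one h2
  simp only [slope_def_field, Function.comp_apply, AffineMap.lineMap_apply_one,
    AffineMap.lineMap_apply_zero, sub_zero, div_one] at h5
  linarith

theorem ConvexOn.le_of_gradient_eq_zero (hf : ConvexOn ℝ univ f) (hd : Differentiable ℝ f)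
    {x : F} (hx : gradient f x = 0) (y : F) : f x ≤ f y := by
  simpa [hx] using hf.add_inner_gradient_le hd x y

theorem gradient_eq_zero_of_forall_le {x : F} (hx : ∀ y, f x ≤ f y) : gradient f x = 0 := by
  have : fderiv ℝ f x = 0 := IsLocalMin.fderiv_eq_zero (Eventually.of_forall hx)
  simp [gradient, this]

variable [FiniteDimensional ℝ F]

/-- A differentiable convex function with a nonempty bounded set of critical points is coercive. -/
theorem ConvexOn.exists_forall_norm_le (hf : ConvexOn ℝ univ f) (hd : Differentiable ℝ f)
    (hne : {s | gradient f s = 0}.Nonempty) (hb : Bornology.IsBounded {s | gradient f s = 0})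
    (c : ℝ) : ∃ R, ∀ s, f s ≤ c → ‖s‖ ≤ R := by
  obtain ⟨x₀, hx₀⟩ := hne
  have hmin := hf.le_of_gradient_eq_zero hd hx₀
  obtain ⟨r, hr0, hr⟩ := hb.subset_ball_lt 0 x₀
  -- Here y is the point where the segment from the minimizer x₀ to s crosses the sphere; convexity
  -- along the segment forces at least linear growth beyond it.
  have hseg : ∀ s, r ≤ ‖s - x₀‖ → ∃ y ∈ Metric.sphere x₀ r,
      f x₀ + ‖s - x₀‖ / r * (f y - f x₀) ≤ f s := by
    intro s hs
    have hpos : 0 < ‖s - x₀‖ := hr0.trans_le hs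
    set θ := r / ‖s - x₀‖ with hθ
    have hθ0 : 0 < θ := by positivity
    have hθ1 : θ ≤ 1 := (div_le_one hpos).2 hs
    refine ⟨(1 - θ) • x₀ + θ • s, ?_, ?_⟩
    · have : (1 - θ) • x₀ + θ • s - x₀ = θ • (s - x₀) := by module
      rw [mem_sphere_iff_norm, this, norm_smul, Real.norm_of_nonneg hθ0.le, hθ,
        div_mul_cancel₀ _ hpos.ne']
    · have h1 := hf.2 (mem_univ x₀) (mem_univ s) (sub_nonneg.2 hθ1) hθ0.le (by ring)
      have h2 : ‖s - x₀‖ / r = θ⁻¹ := by rw [hθ, inv_div]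
      rw [smul_eq_mul, smul_eq_mul] at h1
      rw [h2, ← sub_nonneg]
      have h3 : f s - (f x₀ + θ⁻¹ * (f ((1 - θ) • x₀ + θ • s) - f x₀))
          = θ⁻¹ * ((1 - θ) * f x₀ + θ * f s - f ((1 - θ) • x₀ + θ • s)) := by
        field_simp; ring
      rw [h3]
      exact mul_nonneg (by positivity) (by linarith)
  -- The sphere is empty when the space is trivial.
  rcases (Metric.sphere x₀ r).eq_empty_or_nonempty with he | hsn
  · refine ⟨‖x₀‖ + r, fun s _ => ?_⟩
    by_contra! h
    have := norm_sub_norm_le s x₀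
    obtain ⟨y, hy, -⟩ := hseg s (by linarith)
    simp [he] at hy
  · obtain ⟨y₀, hy₀, hy₀'⟩ := (isCompact_sphere x₀ r).exists_isMinOn hsn hd.continuous.continuousOn
    -- The open ball contains all critical points, so no minimizer lies on the sphere.
    have hδ : 0 < f y₀ - f x₀ := by
      refine sub_pos.2 ((hmin y₀).lt_of_ne fun h => ?_)
      have h2 : y₀ ∈ {s | gradient f s = 0} :=
        gradient_eq_zero_of_forall_le fun y => h ▸ hmin y
      have h3 := hr h2
      rw [Metric.mem_ball] at h3
      rw [Metric.mem_sphere] at hy₀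
      linarith
    refine ⟨‖x₀‖ + r + r * ((c - f x₀) / (f y₀ - f x₀)), fun s hs => ?_⟩
    have hc0 : 0 ≤ c - f x₀ := by linarith [hmin s]
    by_contra! h
    have h1 := norm_sub_norm_le s x₀
    have h2 : 0 ≤ r * ((c - f x₀) / (f y₀ - f x₀)) := by positivity
    obtain ⟨y, hy, hys⟩ := hseg s (by linarith)
    have h3 : f y₀ ≤ f y := hy₀' hy
    have h4 : (c - f x₀) / (f y₀ - f x₀) < ‖s - x₀‖ / r := by
      rw [lt_div_iff₀ hr0]; linarith
    rw [div_lt_iff₀ hδ] at h4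
    have h5 : ‖s - x₀‖ / r * (f y₀ - f x₀) ≤ ‖s - x₀‖ / r * (f y - f x₀) :=
      mul_le_mul_of_nonneg_left (by linarith) (by positivity)
    linarith

/-- The gradient of a differentiable convex function is bounded on bounded sets. -/
theorem ConvexOn.exists_norm_gradient_le (hf : ConvexOn ℝ univ f) (hd : Differentiable ℝ f)
    (R : ℝ) : ∃ C, ∀ x, ‖x‖ ≤ R → ‖gradient f x‖ ≤ C := by
  obtain ⟨B, hB⟩ := (isCompact_closedBall (0 : F) (R + 1)).exists_bound_of_continuousOn
    hd.continuous.continuousOn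
  refine ⟨2 * B, fun x hx => ?_⟩
  by_cases h0 : gradient f x = 0
  · have := (norm_nonneg _).trans (hB x (by simpa using by linarith))
    simp [h0]
    linarith
  have hn : ‖gradient f x‖ ≠ 0 := norm_ne_zero_iff.2 h0
  -- Along this unit vector f grows by at least ‖∇f x‖, while |f| ≤ B on the ball of radius R + 1.
  set u := (‖gradient f x‖⁻¹ : ℝ) • gradient f x with hu
  have hu1 : ‖u‖ = 1 := by rw [hu, norm_smul, norm_inv, norm_norm, inv_mul_cancel₀ hn]
  have h1 := hf.add_inner_gradient_le hd x (x + u)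
  have h2 : inner ℝ (gradient f x) u = ‖gradient f x‖ := by
    rw [hu, inner_smul_right, real_inner_self_eq_norm_sq]; field_simp
  rw [add_sub_cancel_left, h2] at h1
  have h3 := hB x (by simpa using by linarith)
  have h4 := hB (x + u) (by
    simp only [mem_closedBall_zero_iff]
    linarith [norm_add_le x u])
  rw [Real.norm_eq_abs, abs_le] at h3 h4
  linarith

end ConvexLemmas

/-! ### The two Lyapunov functions: distance to a set and dispersion. -/

section SumSqDist

variable {n : ℕ} {F : Type*} [NormedAddCommGroup F]

/-- Half the sum of the squared distances of the entries of a tuple to a set. -/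
noncomputable def sumSqDist (K : Set F) (x : Fin n → F) : ℝ := ∑ i, Metric.infDist (x i) K ^ 2 / 2

theorem sumSqDist_nonneg (K : Set F) (x : Fin n → F) : 0 ≤ sumSqDist K x :=
  Finset.sum_nonneg fun i _ => by positivity

theorem continuous_sumSqDist (K : Set F) : Continuous (sumSqDist K : (Fin n → F) → ℝ) :=
  continuous_finsetSum _ fun i _ =>
    (((Metric.continuous_infDist_pt K).comp (continuous_apply i)).pow 2).div_const 2

theorem infDist_le_of_sumSqDist_le {S : Set F} {y : Fin n → F} {ν : ℝ} (hν : 0 ≤ ν)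
    (hy : sumSqDist S y ≤ ν ^ 2 / 2) (i : Fin n) : Metric.infDist (y i) S ≤ ν := by
  refine (pow_le_pow_iff_left₀ Metric.infDist_nonneg hν two_ne_zero).1 ?_
  have := Finset.single_le_sum (f := fun i => Metric.infDist (y i) S ^ 2 / 2)
    (fun _ _ => by positivity) (Finset.mem_univ i)
  rw [sumSqDist] at hy
  linarith

end SumSqDist

section Dispersion

variable {n : ℕ} {F : Type*} [NormedAddCommGroup F] [NormedSpace ℝ F]

/-- The mean of a tuple of vectors. -/
noncomputable def mean (x : Fin n → F) : F := (1 / (n : ℝ)) • ∑ i, x i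

/-- The dispersion `½ ∑ ‖x_i - x̄‖²` of a tuple of vectors. -/
noncomputable def dispersion (x : Fin n → F) : ℝ := ∑ i, ‖x i - mean x‖ ^ 2 / 2

theorem dispersion_nonneg (x : Fin n → F) : 0 ≤ dispersion x :=
  Finset.sum_nonneg fun i _ => by positivity

theorem continuous_mean : Continuous (mean : (Fin n → F) → F) := by
  unfold mean; fun_prop

theorem continuous_dispersion : Continuous (dispersion : (Fin n → F) → ℝ) := by
  have := continuous_mean (n := n) (F := F)
  unfold dispersion; fun_prop

/-- On bounded tuples, small dispersion and small distances to the sets `H i` force small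
distances to the intersection. -/
theorem exists_pos_sumSqDist_lt [FiniteDimensional ℝ F] {H : Fin n → Set F}
    (hc : ∀ i, IsClosed (H i)) (hne : (⋂ i, H i).Nonempty) (R : ℝ) {δ : ℝ} (hδ : 0 < δ) :
    ∃ ρ > 0, ∀ x : Fin n → F, (∀ i, ‖x i‖ ≤ R) →
      dispersion x + ∑ i, Metric.infDist (x i) (H i) ^ 2 < ρ → sumSqDist (⋂ i, H i) x < δ := by
  have hproper : ProperSpace F := FiniteDimensional.proper_real F
  set Z : Set (Fin n → F) := univ.pi (fun _ => Metric.closedBall (0 : F) R) ∩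
    {x | δ ≤ sumSqDist (⋂ i, H i) x}
  have hZ : IsCompact Z := (isCompact_univ_pi fun _ => isCompact_closedBall _ _).inter_right
    (isClosed_le continuous_const (continuous_sumSqDist _))
  have hcont : Continuous fun x : Fin n → F =>
      dispersion x + ∑ i, Metric.infDist (x i) (H i) ^ 2 :=
    continuous_dispersion.add (continuous_finsetSum _ fun i _ =>
      ((Metric.continuous_infDist_pt (H i)).comp (continuous_apply i)).pow 2)
  have hmem : ∀ x : Fin n → F, (∀ i, ‖x i‖ ≤ R) → δ ≤ sumSqDist (⋂ i, H i) x → x ∈ Z := by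
    intro x hx h
    exact ⟨fun i _ => by simpa using hx i, h⟩
  rcases Z.eq_empty_or_nonempty with he | hZne
  · refine ⟨1, one_pos, fun x hx _ => ?_⟩
    by_contra! h
    have := hmem x hx h
    rw [he] at this
    exact this
  obtain ⟨y, hy, hmin⟩ := hZ.exists_isMinOn hZne hcont.continuousOn
  refine ⟨dispersion y + ∑ i, Metric.infDist (y i) (H i) ^ 2, ?_, fun x hx hlt => ?_⟩
  -- The minimum over Z is positive: if it were 0, all y i would coincide at a point of every H i,
  -- contradicting δ ≤ `sumSqDist`.
  · have h2 : 0 ≤ ∑ i, Metric.infDist (y i) (H i) ^ 2 := by positivity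
    by_contra! h
    have h3 : dispersion y = 0 := le_antisymm (by linarith) (dispersion_nonneg y)
    have h4 : ∑ i, Metric.infDist (y i) (H i) ^ 2 = 0 :=
      le_antisymm (by linarith [dispersion_nonneg y]) h2
    rw [dispersion, Finset.sum_eq_zero_iff_of_nonneg fun i _ => by positivity] at h3
    rw [Finset.sum_eq_zero_iff_of_nonneg fun i _ => by positivity] at h4
    have h5 (i) : y i = mean y := by
      have := h3 i (Finset.mem_univ i)
      simpa [sub_eq_zero] using this
    have h6 (i) : mean y ∈ H i := by
      have h7 := pow_eq_zero_iff two_ne_zero |>.1 (h4 i (Finset.mem_univ i))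
      rw [← h5 i]
      exact ((hc i).mem_iff_infDist_zero (hne.mono (iInter_subset _ i))).2 h7
    have h8 : sumSqDist (⋂ i, H i) y = 0 := by
      refine Finset.sum_eq_zero fun i _ => ?_
      rw [h5 i, Metric.infDist_zero_of_mem (mem_iInter.2 h6)]
      simp
    have := hy.2
    simp only [mem_ofPred_eq, h8] at this
    linarith
  · by_contra! h
    exact (hmin (hmem x hx h)).not_gt hlt

theorem tendsto_sub_mean {x : Fin n → ℝ → F} {l : Filter ℝ}
    (h : Tendsto (fun t => dispersion fun i => x i t) l (𝓝 0)) (i : Fin n) :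
    Tendsto (fun t => x i t - mean fun j => x j t) l (𝓝 0) := by
  have h1 : Tendsto (fun t => √(2 * dispersion fun i => x i t)) l (𝓝 0) := by
    simpa only [mul_zero, Real.sqrt_zero] using (h.const_mul 2).sqrt
  refine squeeze_zero_norm (fun t => Real.le_sqrt_of_sq_le ?_) h1
  have : ‖x i t - mean fun j => x j t‖ ^ 2 / 2 ≤ dispersion fun i => x i t :=
    Finset.single_le_sum (f := fun i => ‖x i t - mean fun j => x j t‖ ^ 2 / 2)
      (fun _ _ => by positivity) (Finset.mem_univ i)
  linarith

theorem tendsto_infDist_mean [Nonempty (Fin n)] {S : Set F} {x : Fin n → ℝ → F} {l : Filter ℝ}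
    (hS : Tendsto (fun t => sumSqDist S fun i => x i t) l (𝓝 0))
    (h : Tendsto (fun t => dispersion fun i => x i t) l (𝓝 0)) :
    Tendsto (fun t => Metric.infDist (mean fun j => x j t) S) l (𝓝 0) := by
  obtain ⟨i⟩ := ‹Nonempty (Fin n)›
  have h1 : Tendsto (fun t => √(2 * sumSqDist S fun i => x i t)) l (𝓝 0) := by
    simpa only [mul_zero, Real.sqrt_zero] using (hS.const_mul 2).sqrt
  have hlim := h1.add (tendsto_sub_mean h i).norm
  rw [norm_zero, add_zero] at hlim
  refine squeeze_zero (fun t => Metric.infDist_nonneg) (fun t => ?_) hlim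
  have h2 : Metric.infDist (x i t) S ≤ √(2 * sumSqDist S fun i => x i t) := by
    refine infDist_le_of_sumSqDist_le (y := fun i => x i t) (Real.sqrt_nonneg _) (le_of_eq ?_) i
    rw [Real.sq_sqrt (mul_nonneg two_pos.le (sumSqDist_nonneg _ _)),
      mul_div_cancel_left₀ _ two_ne_zero]
  have h3 := Metric.infDist_le_infDist_add_dist (s := S) (x := mean fun j => x j t) (y := x i t)
  rw [dist_comm, dist_eq_norm] at h3
  linarith

end Dispersion

/-! ### Calculus across switching times. -/

section Piecewise

theorem exists_mem_Ico_of_tendsto {σ : ℕ → ℝ} (hσ : Tendsto σ atTop atTop) {K : ℕ} {t : ℝ}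
    (ht : σ K ≤ t) : ∃ k, K ≤ k ∧ t ∈ Ico (σ k) (σ (k + 1)) := by
  by_contra! h
  have h1 : ∀ k, K ≤ k → σ k ≤ t := by
    intro k hk
    induction k, hk using Nat.le_induction with
    | base => exact ht
    | succ k hk ih =>
      by_contra! h2
      exact h k hk ⟨ih, h2⟩
  obtain ⟨k, hk, hk'⟩ := ((hσ.eventually_gt_atTop t).and (eventually_ge_atTop K)).exists
  exact (h1 k hk').not_gt hk

/-- A function that is continuous between contiguous switching times, with limits at both ends, is
integrable. -/
theorem intervalIntegrable_of_piecewise {σ : ℕ → ℝ} (h0 : σ 0 = 0) (hm : Monotone σ)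
    (hσ : Tendsto σ atTop atTop) {ψ : ℝ → ℝ}
    (h : ∀ k, ∃ χ : ℝ → ℝ, ContinuousOn χ (Icc (σ k) (σ (k + 1))) ∧
      EqOn χ ψ (Ioo (σ k) (σ (k + 1)))) {a b : ℝ} (ha : 0 ≤ a) (hb : 0 ≤ b) :
    IntervalIntegrable ψ MeasureTheory.volume a b := by
  have h1 : ∀ k, IntervalIntegrable ψ MeasureTheory.volume 0 (σ k) := by
    intro k
    induction k with
    | zero => rw [h0]
    | succ k ih =>
      obtain ⟨χ, hχ, he⟩ := h k
      have hle := hm k.le_succ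
      refine ih.trans (IntervalIntegrable.congr_uIoo (f := χ) ?_ ?_)
      · rw [← uIcc_of_le hle] at hχ
        exact hχ.intervalIntegrable
      · rwa [uIoo_of_le hle]
  have h2 : ∀ c, 0 ≤ c → IntervalIntegrable ψ MeasureTheory.volume 0 c := by
    intro c hc
    obtain ⟨k, hk⟩ := (hσ.eventually_ge_atTop c).exists
    refine (h1 k).mono_set ?_
    rw [uIcc_of_le hc, uIcc_of_le (hc.trans hk)]
    exact Icc_subset_Icc_right hk
  exact (h2 a ha).symm.trans (h2 b hb)

/-- An inequality form of the fundamental theorem of calculus for a continuous function that is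
differentiable off the switching times. -/
theorem sub_le_integral_of_piecewise {σ : ℕ → ℝ} (h0 : σ 0 = 0)
    (hσ : Tendsto σ atTop atTop) {φ φ' ψ : ℝ → ℝ} (hφ : ContinuousOn φ (Ici 0)) {a b : ℝ}
    (ha : 0 ≤ a) (hab : a ≤ b)
    (hψ : ∀ c d, 0 ≤ c → 0 ≤ d → IntervalIntegrable ψ MeasureTheory.volume c d)
    (hd : ∀ k, ∀ t ∈ Ioo (σ k) (σ (k + 1)), t ∈ Ioo a b → HasDerivAt φ (φ' t) t)
    (hle : ∀ k, ∀ t ∈ Ioo (σ k) (σ (k + 1)), t ∈ Ioo a b → φ' t ≤ ψ t) :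
    φ b - φ a ≤ ∫ t in a..b, ψ t := by
  have hsingle : ∀ k c d, a ≤ c → c ≤ d → d ≤ b → σ k ≤ c → d ≤ σ (k + 1) →
      φ d - φ c ≤ ∫ t in c..d, ψ t := by
    intro k c d hac hcd hdb hkc hdk
    have hsub : ∀ t ∈ Ioo c d, t ∈ Ioo (σ k) (σ (k + 1)) ∧ t ∈ Ioo a b := fun t ht =>
      ⟨⟨hkc.trans_lt ht.1, ht.2.trans_le hdk⟩, ⟨hac.trans_lt ht.1, ht.2.trans_le hdb⟩⟩
    refine intervalIntegral.sub_le_integral_of_hasDeriv_right_of_le hcd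
      (hφ.mono fun t ht => (ha.trans hac).trans ht.1)
      (fun t ht => (hd k t (hsub t ht).1 (hsub t ht).2).hasDerivWithinAt) ?_
      (fun t ht => hle k t (hsub t ht).1 (hsub t ht).2)
    exact (intervalIntegrable_iff_integrableOn_Icc_of_le hcd).1
      (hψ c d (ha.trans hac) ((ha.trans hac).trans hcd))
  have hind : ∀ k c, a ≤ c → c ≤ b → c ≤ σ k → φ c - φ a ≤ ∫ t in a..c, ψ t := by
    intro k
    induction k with
    | zero =>
      intro c hac _ hc
      have : c = a := by linarith
      simp [this]
    | succ k ih =>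
      intro c hac hcb hc
      rcases le_total c (σ k) with h1 | h1
      · exact ih c hac hcb h1
      rcases le_total (σ k) a with h2 | h2
      · exact hsingle k a c le_rfl hac hcb h2 hc
      · have h3 := ih (σ k) h2 (h1.trans hcb) le_rfl
        have h4 := hsingle k (σ k) c h2 h1 hcb le_rfl hc
        rw [← intervalIntegral.integral_add_adjacent_intervals
          (hψ a (σ k) ha (ha.trans h2)) (hψ (σ k) c (ha.trans h2) (ha.trans hac))]
        linarith
  obtain ⟨k, hk⟩ := (hσ.eventually_ge_atTop b).exists
  exact hind k b hab le_rfl hk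

/-- A continuous function whose derivative, off the switching times, is nonpositive wherever its
value exceeds `B` stays below `B`. -/
theorem le_of_piecewise_deriv_nonpos {σ : ℕ → ℝ} (h0 : σ 0 = 0)
    (hσ : Tendsto σ atTop atTop) {φ φ' : ℝ → ℝ} (hφ : ContinuousOn φ (Ici 0)) {B : ℝ}
    (hB : φ 0 ≤ B) (hd : ∀ k, ∀ t ∈ Ioo (σ k) (σ (k + 1)), HasDerivAt φ (φ' t) t)
    (hle : ∀ k, ∀ t ∈ Ioo (σ k) (σ (k + 1)), B < φ t → φ' t ≤ 0) {t : ℝ} (ht : 0 ≤ t) :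
    φ t ≤ B := by
  have hcont : ContinuousOn φ (Icc 0 t) := hφ.mono fun s hs => hs.1
  have hcomp : IsCompact (Icc 0 t ∩ φ ⁻¹' Iic B) :=
    isCompact_Icc.of_isClosed_subset (hcont.preimage_isClosed_of_isClosed isClosed_Icc isClosed_Iic)
      inter_subset_left
  -- The last time s ≤ t with φ s ≤ B; after it φ exceeds B, hence does not increase up to t.
  obtain ⟨s, ⟨hs, hsB⟩, hmax⟩ := hcomp.exists_isGreatest ⟨0, ⟨le_rfl, ht⟩, hB⟩
  have h1 := sub_le_integral_of_piecewise h0 hσ hφ hs.1 hs.2 (ψ := fun _ => 0) (φ' := φ')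
    (fun _ _ _ _ => intervalIntegrable_const) (fun k r hr _ => hd k r hr) (fun k r hr hr' => ?_)
  · simp only [intervalIntegral.integral_zero] at h1
    have : φ s ≤ B := hsB
    linarith
  · refine hle k r hr ?_
    by_contra! h
    have := hmax ⟨⟨hs.1.trans hr'.1.le, hr'.2.le⟩, h⟩
    exact this.not_gt hr'.1

end Piecewise

/-! ### Velocity field and derivatives of the Lyapunov functions. -/

section Flow

variable {n : ℕ} {F : Type*} [NormedAddCommGroup F] [InnerProductSpace ℝ F]

/-- The velocity of the agents at the state `x`, for the weights `A`, the constraint sets `K` and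
the perturbation `g`. -/
noncomputable def velocity (A : Matrix (Fin n) (Fin n) ℝ) (K : Fin n → Set F) (g x : Fin n → F)
    (i : Fin n) : F :=
  -(∑ j, A i j • (x i - x j)) - (x i - proj (K i) (x i)) - g i

/-- Every derivative estimate below is read off from this identity through the choice of y:
deviation from a fixed point, from the mean, from the projection, or from an earlier or later state.
-/
theorem sum_inner_velocity (A : Matrix (Fin n) (Fin n) ℝ) (K : Fin n → Set F)
    (g x y : Fin n → F) :
    ∑ i, inner ℝ (y i) (velocity A K g x i)
      = - lapForm A y x - ∑ i, inner ℝ (y i) (x i - proj (K i) (x i)) - ∑ i, inner ℝ (y i) (g i) := by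
  rw [lapForm, ← Finset.sum_neg_distrib, ← Finset.sum_sub_distrib, ← Finset.sum_sub_distrib]
  refine Finset.sum_congr rfl fun i _ => ?_
  rw [velocity, inner_sub_right, inner_sub_right, inner_neg_right, inner_sum]
  simp only [inner_smul_right]

theorem hasDerivAt_sum_norm_sub_sq {x : Fin n → ℝ → F} {x' : Fin n → F} {t : ℝ}
    (hx : ∀ i, HasDerivAt (x i) (x' i) t) (z : Fin n → F) :
    HasDerivAt (fun s => ∑ i, ‖x i s - z i‖ ^ 2 / 2) (∑ i, inner ℝ (x i t - z i) (x' i)) t := by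
  refine HasDerivAt.fun_sum fun i _ => ?_
  have := ((hx i).sub_const (z i)).norm_sq.div_const 2
  rwa [mul_div_cancel_left₀ _ two_ne_zero] at this

theorem sum_sub_mean (x : Fin n → F) : ∑ i, (x i - mean x) = 0 := by
  rcases Nat.eq_zero_or_pos n with rfl | hn
  · simp
  · have : (n : ℝ) ≠ 0 := by positivity
    rw [Finset.sum_sub_distrib, Finset.sum_const, Finset.card_univ, Fintype.card_fin, mean,
      ← Nat.cast_smul_eq_nsmul ℝ, smul_smul, mul_one_div_cancel this, one_smul, sub_self]

/-- The motion of the mean drops out because the deviations from it sum to 0. -/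
theorem hasDerivAt_dispersion {x : Fin n → ℝ → F} {x' : Fin n → F} {t : ℝ}
    (hx : ∀ i, HasDerivAt (x i) (x' i) t) :
    HasDerivAt (fun s => dispersion fun i => x i s)
      (∑ i, inner ℝ (x i t - mean fun i => x i t) (x' i)) t := by
  have hm : HasDerivAt (fun s => mean fun i => x i s) (mean x') t :=
    (HasDerivAt.fun_sum fun i _ => hx i).const_smul (1 / (n : ℝ))
  have h1 : HasDerivAt (fun s => ∑ i, ‖x i s - mean fun i => x i s‖ ^ 2 / 2)
      (∑ i, inner ℝ (x i t - mean fun i => x i t) (x' i - mean x')) t := by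
    refine HasDerivAt.fun_sum fun i _ => ?_
    have := ((hx i).sub hm).norm_sq.div_const 2
    rwa [mul_div_cancel_left₀ _ two_ne_zero] at this
  have h2 : ∑ i, inner ℝ (x i t - mean fun i => x i t) (x' i - mean x')
      = ∑ i, inner ℝ (x i t - mean fun i => x i t) (x' i) := by
    simp only [inner_sub_right _ (x' _), Finset.sum_sub_distrib]
    rw [← sum_inner, sum_sub_mean fun i => x i t, inner_zero_left, sub_zero]
  rwa [h2] at h1

theorem hasDerivAt_sumSqDist [CompleteSpace F] {K : Set F} (hne : K.Nonempty) (hc : IsClosed K)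
    (hK : Convex ℝ K) {x : Fin n → ℝ → F} {x' : Fin n → F} {t : ℝ}
    (hx : ∀ i, HasDerivAt (x i) (x' i) t) :
    HasDerivAt (fun s => sumSqDist K fun i => x i s)
      (∑ i, inner ℝ (x i t - proj K (x i t)) (x' i)) t :=
  HasDerivAt.fun_sum fun i _ => (hasFDerivAt_infDist_sq hne hc hK (x i t)).comp_hasDerivAt t (hx i)

theorem norm_mean_le {x : Fin n → F} {R : ℝ} (hR : 0 ≤ R) (hx : ∀ i, ‖x i‖ ≤ R) :
    ‖mean x‖ ≤ R := by
  rcases Nat.eq_zero_or_pos n with rfl | hn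
  · simpa [mean] using hR
  · have hn' : (0 : ℝ) < n := by positivity
    have := norm_sum_le_of_le Finset.univ fun i _ => hx i
    rw [mean, norm_smul, Real.norm_of_nonneg (by positivity), one_div, inv_mul_le_iff₀ hn']
    simpa using this

end Flow

/-! ### From connectivity to a bound on the dispersion. -/

section Graph

/-- A transitive closure carries no length bound, so directions are forgotten: in a simple graph,
reachable vertices are joined by a path, with fewer edges than there are vertices. -/
theorem norm_sub_le_of_transGen {ι F : Type*} [Fintype ι] [NormedAddCommGroup F] {r : ι → ι → Prop}
    (hr : ∀ i j, i ≠ j → Relation.TransGen r i j) {y : ι → F} {δ : ℝ} (hδ : 0 ≤ δ)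
    (hy : ∀ i j, r i j → ‖y i - y j‖ ≤ δ) (i j : ι) :
    ‖y i - y j‖ ≤ Fintype.card ι * δ := by
  have hadj : ∀ u v, (SimpleGraph.fromRel r).Adj u v → ‖y u - y v‖ ≤ δ := by
    intro u v h
    rcases ((SimpleGraph.fromRel_adj r u v).1 h).2 with h | h
    · exact hy u v h
    · rw [norm_sub_rev]; exact hy v u h
  have hwalk : ∀ u v (p : (SimpleGraph.fromRel r).Walk u v), ‖y u - y v‖ ≤ p.length * δ := by
    intro u v p
    induction p with
    | nil => simp
    | cons h p ih =>
      rw [SimpleGraph.Walk.length_cons]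
      refine (norm_sub_le_norm_sub_add_norm_sub _ _ _).trans (add_le_add (hadj _ _ h) ih) |>.trans ?_
      push_cast
      linarith
  have hstep : ∀ u v, r u v → (SimpleGraph.fromRel r).Reachable u v := by
    intro u v h
    by_cases huv : u = v
    · rw [huv]
    · exact SimpleGraph.Adj.reachable ((SimpleGraph.fromRel_adj r u v).2 ⟨huv, Or.inl h⟩)
  have hreach : ∀ u v, Relation.TransGen r u v → (SimpleGraph.fromRel r).Reachable u v := by
    intro u v h
    induction h with
    | single h => exact hstep _ _ h
    | tail _ h ih => exact ih.trans (hstep _ _ h)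
  by_cases hij : i = j
  · subst hij
    simpa using by positivity
  · obtain ⟨p, hp⟩ := (hreach i j (hr i j hij)).exists_isPath
    refine (hwalk i j p).trans (mul_le_mul_of_nonneg_right ?_ hδ)
    exact_mod_cast hp.length_lt.le

theorem dispersion_le_of_norm_sub_le {n : ℕ} {F : Type*} [NormedAddCommGroup F]
    [InnerProductSpace ℝ F] {x : Fin n → F} {δ : ℝ} (hδ : 0 ≤ δ)
    (hx : ∀ i j, ‖x i - x j‖ ≤ δ) : dispersion x ≤ n * (δ ^ 2 / 2) := by
  have h1 : ∀ i, ‖x i - mean x‖ ≤ δ := by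
    intro i
    have hn : (n : ℝ) ≠ 0 := by
      have : 0 < n := i.pos
      positivity
    have h2 : x i - mean x = mean fun j => x i - x j := by
      rw [mean, mean, Finset.sum_sub_distrib, smul_sub, Finset.sum_const, Finset.card_univ,
        Fintype.card_fin, ← Nat.cast_smul_eq_nsmul ℝ, smul_smul, one_div_mul_cancel hn, one_smul]
    rw [h2]
    exact norm_mean_le hδ (hx i)
  have h3 : ∀ i ∈ Finset.univ, ‖x i - mean x‖ ^ 2 / 2 ≤ δ ^ 2 / 2 := fun i _ => by
    have := pow_le_pow_left₀ (norm_nonneg _) (h1 i) 2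
    linarith
  simpa [dispersion] using Finset.sum_le_sum h3

end Graph

/-! ### The perturbed switched flow and its integral estimates. -/

section Energy

variable {n : ℕ} {F : Type*} [NormedAddCommGroup F]

/-- The Dirichlet energy along the flow. -/
noncomputable def flowEnergy (A : ℝ → Matrix (Fin n) (Fin n) ℝ) (x : Fin n → ℝ → F)
    (t : ℝ) : ℝ :=
  dirichletEnergy (A t) fun i => x i t

/-- A bound for the total size of everything but the consensus term in the dynamics. -/
noncomputable def flowForcing (K : Fin n → Set F) (ε : ℝ) (x : Fin n → ℝ → F) (t : ℝ) : ℝ :=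
  ∑ i, (Metric.infDist (x i t) (K i) + ε)

theorem flowForcing_nonneg {K : Fin n → Set F} {ε : ℝ} (hε : 0 ≤ ε) (x : Fin n → ℝ → F)
    (t : ℝ) : 0 ≤ flowForcing K ε x t :=
  Finset.sum_nonneg fun _ _ => add_nonneg Metric.infDist_nonneg hε

theorem ContinuousOn.intervalIntegrable_of_Ici {φ : ℝ → ℝ} (hφ : ContinuousOn φ (Ici 0))
    (a b : ℝ) (ha : 0 ≤ a) (hb : 0 ≤ b) : IntervalIntegrable φ MeasureTheory.volume a b :=
  (hφ.mono fun _ ht => (le_min ha hb).trans ht.1).intervalIntegrable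

end Energy

section Flow

variable {n : ℕ} {F : Type*} [NormedAddCommGroup F] [InnerProductSpace ℝ F]

/-- `x` is a solution of the perturbed projected consensus dynamics with balanced switching weights
`A`, switching times `σ` with dwell time `dw`, constraint sets `K` and perturbation `g`. -/
structure IsFlow (dw : ℝ) (A : ℝ → Matrix (Fin n) (Fin n) ℝ) (σ : ℕ → ℝ) (K : Fin n → Set F)
    (g x : Fin n → ℝ → F) : Prop where
  dw_pos : 0 < dw
  zero : σ 0 = 0
  dwell : ∀ k, dw ≤ σ (k + 1) - σ k
  const : ∀ k, ∀ t ∈ Ico (σ k) (σ (k + 1)), A t = A (σ k)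
  weight_nonneg : ∀ t i j, 0 ≤ A t i j
  balanced : ∀ t, 0 ≤ t → ∀ i, ∑ j, A t i j = ∑ j, A t j i
  closed : ∀ i, IsClosed (K i)
  convex : ∀ i, Convex ℝ (K i)
  nonempty : (⋂ i, K i).Nonempty
  cont : ∀ i, ContinuousOn (x i) (Ici 0)
  deriv : ∀ i k, ∀ t ∈ Ioo (σ k) (σ (k + 1)),
    HasDerivAt (x i) (velocity (A t) K (fun j => g j t) (fun j => x j t) i) t

namespace IsFlow

variable {dw : ℝ} {A : ℝ → Matrix (Fin n) (Fin n) ℝ} {σ : ℕ → ℝ} {K : Fin n → Set F}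
  {g x : Fin n → ℝ → F}

section Times

theorem strictMono (h : IsFlow dw A σ K g x) : StrictMono σ :=
  strictMono_nat_of_lt_succ fun k => by linarith [h.dw_pos, h.dwell k]

theorem switch_nonneg (h : IsFlow dw A σ K g x) (k : ℕ) : 0 ≤ σ k := by
  rw [← h.zero]; exact h.strictMono.monotone k.zero_le

theorem mul_dwell_le (h : IsFlow dw A σ K g x) {k l : ℕ} (hkl : k ≤ l) :
    ((l : ℝ) - k) * dw ≤ σ l - σ k := by
  induction l, hkl using Nat.le_induction with
  | base => simp
  | succ l _ ih =>
    have := h.dwell l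
    push_cast
    linarith

theorem tendsto_switch (h : IsFlow dw A σ K g x) : Tendsto σ atTop atTop := by
  refine tendsto_atTop_mono (fun k => ?_) (tendsto_natCast_atTop_atTop.atTop_mul_const h.dw_pos)
  have := h.mul_dwell_le k.zero_le
  rw [h.zero] at this
  simpa using this

end Times

theorem set_nonempty (h : IsFlow dw A σ K g x) (i : Fin n) : (K i).Nonempty :=
  h.nonempty.mono (iInter_subset _ i)

theorem continuousOn_state (h : IsFlow dw A σ K g x) :
    ContinuousOn (fun t i => x i t) (Ici 0) := continuousOn_pi.2 h.cont

theorem flowEnergy_nonneg (h : IsFlow dw A σ K g x) (t : ℝ) : 0 ≤ flowEnergy A x t :=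
  dirichletEnergy_nonneg (h.weight_nonneg t) _

theorem continuousOn_infDist (h : IsFlow dw A σ K g x) (i : Fin n) :
    ContinuousOn (fun t => Metric.infDist (x i t) (K i)) (Ici 0) :=
  (Metric.continuous_infDist_pt _).comp_continuousOn (h.cont i)

theorem continuousOn_flowForcing (h : IsFlow dw A σ K g x) (ε : ℝ) :
    ContinuousOn (flowForcing K ε x) (Ici 0) :=
  continuousOn_finsetSum _ fun i _ => (h.continuousOn_infDist i).add continuousOn_const

theorem continuousOn_dirichletEnergy (h : IsFlow dw A σ K g x)
    (B : Matrix (Fin n) (Fin n) ℝ) :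
    ContinuousOn (fun t => dirichletEnergy B fun i => x i t) (Ici 0) :=
  continuousOn_finsetSum _ fun i _ => continuousOn_finsetSum _ fun j _ =>
    continuousOn_const.mul ((((h.cont i).sub (h.cont j)).norm.pow 2).div_const 2)

theorem intervalIntegrable_flowEnergy (h : IsFlow dw A σ K g x) (a b : ℝ) (ha : 0 ≤ a)
    (hb : 0 ≤ b) : IntervalIntegrable (flowEnergy A x) MeasureTheory.volume a b := by
  refine intervalIntegrable_of_piecewise h.zero h.strictMono.monotone h.tendsto_switch
    (fun k => ⟨fun t => dirichletEnergy (A (σ k)) fun i => x i t, ?_, fun t ht => ?_⟩) ha hb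
  · exact (h.continuousOn_dirichletEnergy _).mono fun t ht => (h.switch_nonneg k).trans ht.1
  · simp only [flowEnergy, h.const k t ⟨ht.1.le, ht.2⟩]

theorem integral_mono_interval_of_nonneg {ψ : ℝ → ℝ}
    (hψ : ∀ a b, 0 ≤ a → 0 ≤ b → IntervalIntegrable ψ MeasureTheory.volume a b)
    (h0 : ∀ t, 0 ≤ ψ t) {a b c d : ℝ} (ha : 0 ≤ a) (hac : a ≤ c) (hcd : c ≤ d) (hdb : d ≤ b) :
    ∫ t in c..d, ψ t ≤ ∫ t in a..b, ψ t :=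
  intervalIntegral.integral_mono_interval hac hcd hdb (Eventually.of_forall h0)
    (hψ a b ha (ha.trans (hac.trans (hcd.trans hdb))))

section Estimates

variable [CompleteSpace F] {R T ε : ℝ}

/-- A bound for the forcing terms paired with test vectors of norm at most `c`. -/
theorem sum_abs_inner_forcing_le (h : IsFlow dw A σ K g x) {t c : ℝ} (hc : 0 ≤ c)
    (hg : ∀ i, ‖g i t‖ ≤ ε) {y : Fin n → F} (hy : ∀ i, ‖y i‖ ≤ c) :
    |∑ i, inner ℝ (y i) (x i t - proj (K i) (x i t)) + ∑ i, inner ℝ (y i) (g i t)|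
      ≤ c * flowForcing K ε x t := by
  rw [← Finset.sum_add_distrib, flowForcing, Finset.mul_sum]
  refine (Finset.abs_sum_le_sum_abs _ _).trans (Finset.sum_le_sum fun i _ => ?_)
  rw [← inner_add_right]
  refine (abs_real_inner_le_norm _ _).trans ?_
  refine mul_le_mul (hy i) ((norm_add_le _ _).trans ?_) (norm_nonneg _) hc
  rw [norm_sub_proj_eq_infDist (h.set_nonempty i) (h.closed i) (h.convex i)]
  exact add_le_add le_rfl (hg i)

theorem dispersion_sub_le (h : IsFlow dw A σ K g x) (hR0 : 0 ≤ R)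
    (hR : ∀ i t, 0 ≤ t → ‖x i t‖ ≤ R) (hT : 0 ≤ T) (hg : ∀ i t, T ≤ t → ‖g i t‖ ≤ ε) {a b : ℝ}
    (ha : T ≤ a) (hab : a ≤ b) :
    dispersion (fun i => x i b) - dispersion (fun i => x i a)
      ≤ 2 * R * (∫ t in a..b, flowForcing K ε x t) - ∫ t in a..b, flowEnergy A x t := by
  have ha0 := hT.trans ha
  have hb0 := ha0.trans hab
  have hE := h.intervalIntegrable_flowEnergy
  have hF := (h.continuousOn_flowForcing ε).intervalIntegrable_of_Ici
  rw [← intervalIntegral.integral_const_mul,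
    ← intervalIntegral.integral_sub ((hF a b ha0 hb0).const_mul _) (hE a b ha0 hb0)]
  refine sub_le_integral_of_piecewise h.zero h.tendsto_switch
    (continuous_dispersion.comp_continuousOn h.continuousOn_state) ha0 hab
    (fun c d hc hd => ((hF c d hc hd).const_mul _).sub (hE c d hc hd))
    (fun k t ht _ => hasDerivAt_dispersion fun i => h.deriv i k t ht) (fun k t ht htab => ?_)
  have ht0 : 0 ≤ t := ha0.trans htab.1.le
  rw [sum_inner_velocity, lapForm_sub_const (h.balanced t ht0)]
  have := h.sum_abs_inner_forcing_le (t := t) (c := 2 * R) (by positivity)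
    (fun i => hg i t (ha.trans htab.1.le)) (y := fun i => x i t - mean fun i => x i t) fun i => by
      refine (norm_sub_le _ _).trans ?_
      linarith [hR i t ht0, norm_mean_le hR0 fun i => hR i t ht0]
  have := neg_le_of_abs_le this
  simp only [flowEnergy]
  linarith

/-- Consensus only helps, by `lapForm_sub_proj_nonneg`. The pull towards K i yields at least the
square of the distance to K i, because the nearest point of the intersection lies in K i. The
perturbation is paired with vectors of norm at most 2R. -/
theorem sumSqDist_sub_le (h : IsFlow dw A σ K g x) (hR0 : 0 ≤ R)
    (hR : ∀ i t, 0 ≤ t → ‖x i t‖ ≤ R) {z : F} (hz : z ∈ ⋂ i, K i) (hzR : ‖z‖ ≤ R) (hT : 0 ≤ T)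
    (hg : ∀ i t, T ≤ t → ‖g i t‖ ≤ ε) {a b : ℝ} (ha : T ≤ a) (hab : a ≤ b) :
    sumSqDist (⋂ i, K i) (fun i => x i b) - sumSqDist (⋂ i, K i) (fun i => x i a)
      ≤ 2 * R * n * ε * (b - a) - ∫ t in a..b, ∑ i, Metric.infDist (x i t) (K i) ^ 2 := by
  have ha0 := hT.trans ha
  have hb0 := ha0.trans hab
  have hcl : IsClosed (⋂ i, K i) := isClosed_iInter h.closed
  have hcv : Convex ℝ (⋂ i, K i) := convex_iInter h.convex
  have hQ : ContinuousOn (fun t => ∑ i, Metric.infDist (x i t) (K i) ^ 2) (Ici 0) :=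
    continuousOn_finsetSum _ fun i _ => (h.continuousOn_infDist i).pow 2
  have hQ' := hQ.intervalIntegrable_of_Ici
  have hc : ∫ _ in a..b, 2 * R * n * ε = 2 * R * n * ε * (b - a) := by
    rw [intervalIntegral.integral_const, smul_eq_mul, mul_comm]
  rw [← hc, ← intervalIntegral.integral_sub intervalIntegrable_const (hQ' a b ha0 hb0)]
  refine sub_le_integral_of_piecewise h.zero h.tendsto_switch
    ((continuous_sumSqDist _).comp_continuousOn h.continuousOn_state) ha0 hab
    (fun c d hc hd => intervalIntegrable_const.sub (hQ' c d hc hd))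
    (fun k t ht _ => hasDerivAt_sumSqDist h.nonempty hcl hcv fun i => h.deriv i k t ht)
    (fun k t ht htab => ?_)
  have ht0 : 0 ≤ t := ha0.trans htab.1.le
  rw [sum_inner_velocity]
  have h1 := lapForm_sub_proj_nonneg (h.weight_nonneg t) (h.balanced t ht0) h.nonempty hcl hcv
    fun i => x i t
  have h2 : ∑ i, Metric.infDist (x i t) (K i) ^ 2 ≤
      ∑ i, inner ℝ (x i t - proj (⋂ i, K i) (x i t)) (x i t - proj (K i) (x i t)) := by
    refine Finset.sum_le_sum fun i _ => ?_
    rw [← norm_sub_proj_eq_infDist (h.set_nonempty i) (h.closed i) (h.convex i)]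
    exact norm_sub_proj_sq_le_inner (h.set_nonempty i) (h.closed i) (h.convex i) _
      (mem_iInter.1 (proj_spec h.nonempty hcl hcv (x i t)).1 i)
  have h3 : ∑ i, -inner ℝ (x i t - proj (⋂ i, K i) (x i t)) (g i t)
      ≤ ∑ _i : Fin n, 2 * R * ε := by
    refine Finset.sum_le_sum fun i _ => ?_
    refine (neg_le_abs _).trans ((abs_real_inner_le_norm _ _).trans ?_)
    refine mul_le_mul ?_ (hg i t (ha.trans htab.1.le)) (norm_nonneg _) (by positivity)
    refine ((proj_spec h.nonempty hcl hcv (x i t)).2 z hz).trans ((norm_sub_le _ _).trans ?_)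
    linarith [hR i t ht0]
  rw [Finset.sum_neg_distrib, Finset.sum_const, Finset.card_univ, Fintype.card_fin,
    nsmul_eq_mul] at h3
  linarith

/-- On an interval between contiguous switching times, the displacement of the agents is controlled
by the energy and the forcing. -/
theorem exists_displacement_le (h : IsFlow dw A σ K g x) (hR0 : 0 ≤ R)
    (hR : ∀ i t, 0 ≤ t → ‖x i t‖ ≤ R) (hε : 0 ≤ ε)
    (hg : ∀ i t, T ≤ t → ‖g i t‖ ≤ ε) {k : ℕ} (hk : T ≤ σ k) :
    ∃ r ∈ Icc (σ k) (σ (k + 1)),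
      dw * dirichletEnergy (A (σ k)) (fun i => x i r)
        ≤ ∫ t in σ k..σ (k + 1), flowEnergy A x t ∧
      ∀ t ∈ Icc (σ k) (σ (k + 1)), ∀ i, ‖x i t - x i r‖ ^ 2 / 2
        ≤ (1 + 2 * sectorConst n) * (∫ t in σ k..σ (k + 1), flowEnergy A x t)
          + 2 * R * ∫ t in σ k..σ (k + 1), flowForcing K ε x t := by
  have hlt : σ k < σ (k + 1) := h.strictMono k.lt_succ_self
  have hk0 := h.switch_nonneg k
  have hk1 := h.switch_nonneg (k + 1)
  set B := A (σ k) with hB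
  have hBn : ∀ i j, 0 ≤ B i j := h.weight_nonneg _
  have hBb : ∀ i, ∑ j, B i j = ∑ j, B j i := h.balanced _ hk0
  set e : ℝ → ℝ := fun t => dirichletEnergy B fun i => x i t with he
  have hec : ContinuousOn e (Ici 0) := h.continuousOn_dirichletEnergy B
  have hei := hec.intervalIntegrable_of_Ici
  have he0 : ∀ t, 0 ≤ e t := fun t => dirichletEnergy_nonneg hBn _
  have hFi := (h.continuousOn_flowForcing ε).intervalIntegrable_of_Ici
  have hF0 := flowForcing_nonneg (K := K) hε x
  have hEe : ∫ t in σ k..σ (k + 1), flowEnergy A x t = ∫ t in σ k..σ (k + 1), e t :=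
    intervalIntegral.integral_congr_Ioo_of_le hlt.le fun t ht => by
      simp only [flowEnergy, h.const k t ⟨ht.1.le, ht.2⟩, he, hB]
  rw [hEe]
  -- The reference time r minimizes the energy on the interval, so the energy at r times the
  -- interval's length is at most the integral.
  obtain ⟨r, hr, hmin⟩ := isCompact_Icc.exists_isMinOn (nonempty_Icc.2 hlt.le)
    (hec.mono fun t (ht : t ∈ Icc (σ k) (σ (k + 1))) => hk0.trans ht.1)
  have hmin' : (σ (k + 1) - σ k) * e r ≤ ∫ t in σ k..σ (k + 1), e t := by
    have : ∫ _ in σ k..σ (k + 1), e r = (σ (k + 1) - σ k) * e r := by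
      rw [intervalIntegral.integral_const, smul_eq_mul]
    rw [← this]
    exact intervalIntegral.integral_mono_on hlt.le intervalIntegrable_const
      (hei _ _ hk0 hk1) fun t ht => hmin ht
  refine ⟨r, hr, (mul_le_mul_of_nonneg_right (h.dwell k) (he0 r)).trans hmin', ?_⟩
  have hr0 : 0 ≤ r := hk0.trans hr.1
  set C := sectorConst n with hC
  have hC0 : 0 ≤ C := sectorConst_nonneg n
  set ψ : ℝ → ℝ := fun t => (1 + C) * e t + C * e r + 2 * R * flowForcing K ε x t with hψ
  have hψi : ∀ a b, 0 ≤ a → 0 ≤ b → IntervalIntegrable ψ MeasureTheory.volume a b :=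
    fun a b ha hb => (((hei a b ha hb).const_mul _).add intervalIntegrable_const).add
      ((hFi a b ha hb).const_mul _)
  have hψ0 : ∀ t, 0 ≤ ψ t := fun t => by
    have := he0 t; have := he0 r; have := hF0 t
    positivity
  have hψint : ∫ t in σ k..σ (k + 1), ψ t
      ≤ (1 + 2 * C) * (∫ t in σ k..σ (k + 1), e t)
        + 2 * R * ∫ t in σ k..σ (k + 1), flowForcing K ε x t := by
    have h1 := hei _ _ hk0 hk1
    have h2 := hFi _ _ hk0 hk1
    rw [hψ, intervalIntegral.integral_add ((h1.const_mul _).add intervalIntegrable_const)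
      (h2.const_mul _), intervalIntegral.integral_add (h1.const_mul _) intervalIntegrable_const,
      intervalIntegral.integral_const_mul (1 + C), intervalIntegral.integral_const_mul (2 * R),
      intervalIntegral.integral_const, smul_eq_mul]
    nlinarith
  set φ : ℝ → ℝ := fun s => ∑ i, ‖x i s - x i r‖ ^ 2 / 2 with hφ
  set φ' : ℝ → ℝ := fun s => ∑ i, inner ℝ (x i s - x i r)
    (velocity (A s) K (fun j => g j s) (fun j => x j s) i) with hφ'
  have hφc : ContinuousOn φ (Ici 0) := continuousOn_finsetSum _ fun i _ =>
    (((h.cont i).sub continuousOn_const).norm.pow 2).div_const 2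
  have hφd : ∀ l, ∀ t ∈ Ioo (σ l) (σ (l + 1)), HasDerivAt φ (φ' t) t := fun l t ht =>
    hasDerivAt_sum_norm_sub_sq (fun i => h.deriv i l t ht) _
  -- Testing with x(t) - x(r) splits the Laplacian form into the energy at t and a cross term; the
  -- sector inequality bounds the latter by the energies at t and r, whatever the size of the
  -- weights.
  have hφψ : ∀ t ∈ Ioo (σ k) (σ (k + 1)), |φ' t| ≤ ψ t := by
    intro t ht
    have ht0 : 0 ≤ t := hk0.trans ht.1.le
    have h1 := h.sum_abs_inner_forcing_le (t := t) (c := 2 * R) (by positivity)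
      (fun i => hg i t (hk.trans ht.1.le)) (y := fun i => x i t - x i r) fun i => by
        refine (norm_sub_le _ _).trans ?_
        linarith [hR i t ht0, hR i r hr0]
    have h2 := abs_lapForm_le hBn hBb (fun i => x i r) (fun i => x i t)
    simp only [hφ', hψ]
    rw [sum_inner_velocity, h.const k t ⟨ht.1.le, ht.2⟩,
      lapForm_sub_left _ (fun i => x i t) (fun i => x i r), lapForm_self hBb]
    rw [abs_le] at h1 h2 ⊢
    have := he0 t
    have := he0 r
    simp only [he] at *
    constructor <;> nlinarith
  have hsame : ∀ l, ∀ c d, σ k ≤ c → d ≤ σ (k + 1) → ∀ t ∈ Ioo (σ l) (σ (l + 1)),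
      t ∈ Ioo c d → |φ' t| ≤ ψ t := fun l c d hc hd t _ htcd =>
    hφψ t ⟨hc.trans_lt htcd.1, htcd.2.trans_le hd⟩
  have hφr : φ r = 0 := by simp [hφ]
  intro t ht i
  have h1 : φ t ≤ ∫ t in σ k..σ (k + 1), ψ t := by
    rcases le_total r t with hrt | hrt
    · have h2 := sub_le_integral_of_piecewise h.zero h.tendsto_switch hφc hr0 hrt hψi
        (fun l s hs _ => hφd l s hs)
        (fun l s hs hs' => (le_abs_self _).trans (hsame l r t hr.1 ht.2 s hs hs'))
      have h3 := integral_mono_interval_of_nonneg hψi hψ0 hk0 hr.1 hrt ht.2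
      linarith
    · have h2 := sub_le_integral_of_piecewise h.zero h.tendsto_switch hφc.fun_neg
        (hk0.trans ht.1) hrt hψi
        (fun l s hs _ => (hφd l s hs).fun_neg)
        (fun l s hs hs' => (neg_le_abs _).trans (hsame l t r ht.1 hr.2 s hs hs'))
      have h3 := integral_mono_interval_of_nonneg hψi hψ0 hk0 ht.1 hrt hr.2
      linarith
  refine le_trans ?_ (h1.trans hψint)
  exact Finset.single_le_sum (f := fun i => ‖x i t - x i r‖ ^ 2 / 2) (fun _ _ => by positivity)
    (Finset.mem_univ i)

end Estimates

end IsFlow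

end Flow

/-! ### Contraction of the dispersion over a connected window. -/

section Window

variable {n : ℕ} {F : Type*} [NormedAddCommGroup F] [InnerProductSpace ℝ F] [CompleteSpace F]
  {dw η M : ℝ} {A : ℝ → Matrix (Fin n) (Fin n) ℝ} {σ : ℕ → ℝ} {K : Fin n → Set F}
  {g x : Fin n → ℝ → F} {R T ε : ℝ}

/-- The constant in `IsFlow.displacement_sq_le`. -/
noncomputable def displacementConst (n : ℕ) (R : ℝ) : ℝ := 2 * (1 + 2 * sectorConst n + 2 * R)

/-- The constant in `IsFlow.dispersion_le`. -/
noncomputable def windowConst (n : ℕ) (R dw η M : ℝ) : ℝ :=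
  n * ((n * (4 * (M / dw) * √(displacementConst n R) + √(2 / (dw * η)))) ^ 2 / 2)

theorem windowConst_nonneg (n : ℕ) (R dw η M : ℝ) : 0 ≤ windowConst n R dw η M := by
  unfold windowConst; positivity

namespace IsFlow

/-- Over a window on which the union of the graphs is strongly connected, the initial dispersion is
controlled by the energy and the forcing. -/
theorem dispersion_le (h : IsFlow dw A σ K g x) (hη : 0 < η) (hR0 : 0 ≤ R)
    (hR : ∀ i t, 0 ≤ t → ‖x i t‖ ≤ R) (hε : 0 ≤ ε)
    (hg : ∀ i t, T ≤ t → ‖g i t‖ ≤ ε) {k l : ℕ} (hkl : k ≤ l) (hk : T ≤ σ k)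
    (hM : σ l - σ k ≤ M)
    (hconn : ∀ i j, i ≠ j →
      Relation.TransGen (fun i j => ∃ t ∈ Ico (σ k) (σ l), η ≤ A t j i) i j) :
    dispersion (fun i => x i (σ k)) ≤ windowConst n R dw η M *
      ((∫ t in σ k..σ l, flowEnergy A x t) + ∫ t in σ k..σ l, flowForcing K ε x t) := by
  have hdw := h.dw_pos
  have hmono := h.strictMono.monotone
  have hk0 := h.switch_nonneg k
  have hEi := h.intervalIntegrable_flowEnergy
  have hFi := (h.continuousOn_flowForcing ε).intervalIntegrable_of_Ici
  have hE0 := h.flowEnergy_nonneg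
  have hF0 := flowForcing_nonneg (K := K) hε x
  set D := ∫ t in σ k..σ l, flowEnergy A x t with hD
  set P := ∫ t in σ k..σ l, flowForcing K ε x t with hP
  have hD0 : 0 ≤ D := intervalIntegral.integral_nonneg (hmono hkl) fun t _ => hE0 t
  have hP0 : 0 ≤ P := intervalIntegral.integral_nonneg (hmono hkl) fun t _ => hF0 t
  have hC0 := sectorConst_nonneg n
  set B := displacementConst n R with hB
  have hB0 : 0 ≤ B := by rw [hB, displacementConst]; positivity
  set s := √(B * (D + P)) with hs
  have hpiece : ∀ m, k ≤ m → m + 1 ≤ l → ∃ r ∈ Icc (σ m) (σ (m + 1)),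
      dw * dirichletEnergy (A (σ m)) (fun i => x i r) ≤ D ∧
      ∀ t ∈ Icc (σ m) (σ (m + 1)), ∀ i, ‖x i t - x i r‖ ≤ s := by
    intro m hkm hml
    obtain ⟨r, hr, h1, h2⟩ := h.exists_displacement_le hR0 hR hε hg (hk.trans (hmono hkm))
    have h3 := integral_mono_interval_of_nonneg hEi hE0 hk0 (hmono hkm) (hmono m.le_succ) (hmono hml)
    have h4 := integral_mono_interval_of_nonneg hFi hF0 hk0 (hmono hkm) (hmono m.le_succ) (hmono hml)
    refine ⟨r, hr, h1.trans h3, fun t ht i => Real.le_sqrt_of_sq_le ?_⟩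
    have h5 := h2 t ht i
    have h6 := mul_le_mul_of_nonneg_left h3 (by positivity : 0 ≤ 1 + 2 * sectorConst n)
    have h7 := mul_le_mul_of_nonneg_left h4 (by positivity : 0 ≤ 2 * R)
    have h8 : 0 ≤ 2 * R * D := by positivity
    have h9 : 0 ≤ (1 + 2 * sectorConst n) * P := by positivity
    rw [hB, displacementConst]
    nlinarith
  have htwo : ∀ m, k ≤ m → m + 1 ≤ l → ∀ t ∈ Icc (σ m) (σ (m + 1)),
      ∀ u ∈ Icc (σ m) (σ (m + 1)), ∀ i, ‖x i t - x i u‖ ≤ 2 * s := by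
    intro m hkm hml t ht u hu i
    obtain ⟨r, -, -, h2⟩ := hpiece m hkm hml
    have := norm_sub_le_norm_sub_add_norm_sub (x i t) (x i r) (x i u)
    have h3 := h2 t ht i
    have h4 := h2 u hu i
    rw [norm_sub_rev] at h4
    linarith
  have hs0 : 0 ≤ s := Real.sqrt_nonneg _
  have hchain : ∀ m, k ≤ m → m ≤ l → ∀ i, ‖x i (σ m) - x i (σ k)‖ ≤ ((m : ℝ) - k) * (2 * s) := by
    intro m hkm
    induction m, hkm using Nat.le_induction with
    | base => simp
    | succ m hkm ih =>
      intro hml i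
      have h1 := ih (by omega) i
      have h2 := htwo m hkm hml _ (right_mem_Icc.2 (hmono m.le_succ)) _
        (left_mem_Icc.2 (hmono m.le_succ)) i
      have := norm_sub_le_norm_sub_add_norm_sub (x i (σ (m + 1))) (x i (σ m)) (x i (σ k))
      push_cast
      linarith
  -- The dwell time bounds the number of switching intervals in the window, hence the accumulated
  -- drift.
  have hcount : ((l : ℝ) - k) ≤ M / dw := by
    rw [le_div_iff₀ hdw]
    exact (h.mul_dwell_le hkl).trans hM
  have hdrift : ∀ m, k ≤ m → m + 1 ≤ l → ∀ t ∈ Icc (σ m) (σ (m + 1)), ∀ i,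
      ‖x i t - x i (σ k)‖ ≤ M / dw * (2 * s) := by
    intro m hkm hml t ht i
    have h1 := hchain m hkm (by omega) i
    have h2 := htwo m hkm hml t ht _ (left_mem_Icc.2 (hmono m.le_succ)) i
    have := norm_sub_le_norm_sub_add_norm_sub (x i t) (x i (σ m)) (x i (σ k))
    have h3 : ((m : ℝ) - k + 1) * (2 * s) ≤ M / dw * (2 * s) := by
      refine mul_le_mul_of_nonneg_right (le_trans ?_ hcount) (by positivity)
      have : ((m : ℝ) + 1) ≤ l := by exact_mod_cast hml
      linarith
    linarith
  -- The first term is the drift of both ends of an edge from the window's start to the time r of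
  -- low energy; the second is their separation at r, where an edge of weight at least η has η‖x_i -
  -- x_j‖²/2 ≤ D/dw.
  set δ := 4 * (M / dw) * s + √(2 / (dw * η) * (D + P)) with hδ
  have hMdw : 0 ≤ M / dw := by
    refine le_trans ?_ hcount
    have : (k : ℝ) ≤ l := by exact_mod_cast hkl
    linarith
  have hδ0 : 0 ≤ δ := by positivity
  have hedge : ∀ i j, (∃ t ∈ Ico (σ k) (σ l), η ≤ A t j i) →
      ‖x i (σ k) - x j (σ k)‖ ≤ δ := by
    rintro i j ⟨t, ht, hηt⟩
    obtain ⟨m, hkm, hm⟩ := exists_mem_Ico_of_tendsto h.tendsto_switch ht.1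
    have hml : m + 1 ≤ l := h.strictMono.lt_iff_lt.1 (hm.1.trans_lt ht.2)
    rw [h.const m t hm] at hηt
    obtain ⟨r, hr, h1, -⟩ := hpiece m hkm hml
    have h2 := hdrift m hkm hml r hr i
    have h3 := hdrift m hkm hml r hr j
    have h4 := le_dirichletEnergy (h.weight_nonneg (σ m)) (fun i => x i r) j i
    have h5 : ‖x i r - x j r‖ ≤ √(2 / (dw * η) * (D + P)) := by
      refine Real.le_sqrt_of_sq_le ?_
      rw [div_mul_eq_mul_div, le_div_iff₀ (by positivity), norm_sub_rev]
      have h6 : η * (‖x j r - x i r‖ ^ 2 / 2) ≤ A (σ m) j i * (‖x j r - x i r‖ ^ 2 / 2) :=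
        mul_le_mul_of_nonneg_right hηt (by positivity)
      have h7 := mul_le_mul_of_nonneg_left (h6.trans h4) hdw.le
      linarith
    have h6 := norm_sub_le_norm_sub_add_norm_sub (x i (σ k)) (x i r) (x j (σ k))
    have h7 := norm_sub_le_norm_sub_add_norm_sub (x i r) (x j r) (x j (σ k))
    rw [norm_sub_rev (x i (σ k)) (x i r)] at h6
    rw [hδ]
    linarith
  have hall := dispersion_le_of_norm_sub_le (x := fun i => x i (σ k)) (δ := n * δ) (by positivity)
    fun i j => by
      simpa using norm_sub_le_of_transGen (y := fun i => x i (σ k)) hconn hδ0 hedge i j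
  refine hall.trans (le_of_eq ?_)
  have hDP : √(D + P) ^ 2 = D + P := Real.sq_sqrt (by positivity)
  rw [windowConst, hδ, hs, Real.sqrt_mul hB0, Real.sqrt_mul (by positivity), ← hB]
  calc _ = n * ((n * (4 * (M / dw) * √B + √(2 / (dw * η)))) ^ 2 / 2) * √(D + P) ^ 2 := by ring
    _ = _ := by rw [hDP]

/-- Contraction of the dispersion over a strongly connected window. -/
theorem dispersion_contraction (h : IsFlow dw A σ K g x) (hη : 0 < η) (hR0 : 0 ≤ R)
    (hR : ∀ i t, 0 ≤ t → ‖x i t‖ ≤ R) (hT : 0 ≤ T) (hε : 0 ≤ ε)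
    (hg : ∀ i t, T ≤ t → ‖g i t‖ ≤ ε) {k l : ℕ} (hkl : k ≤ l) (hk : T ≤ σ k)
    (hM : σ l - σ k ≤ M)
    (hconn : ∀ i j, i ≠ j →
      Relation.TransGen (fun i j => ∃ t ∈ Ico (σ k) (σ l), η ≤ A t j i) i j) :
    dispersion (fun i => x i (σ l)) ≤
      (1 - (windowConst n R dw η M + 1)⁻¹) * dispersion (fun i => x i (σ k))
        + (1 + 2 * R) * ∫ t in σ k..σ l, flowForcing K ε x t := by
  have h1 := h.dispersion_le hη hR0 hR hε hg hkl hk hM hconn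
  have h2 := h.dispersion_sub_le hR0 hR hT hg hk (h.strictMono.monotone hkl)
  have hC := windowConst_nonneg n R dw η M
  set C := windowConst n R dw η M
  set D := ∫ t in σ k..σ l, flowEnergy A x t
  set P := ∫ t in σ k..σ l, flowForcing K ε x t
  have hD0 : 0 ≤ D := intervalIntegral.integral_nonneg (h.strictMono.monotone hkl)
    fun t _ => h.flowEnergy_nonneg t
  have hP0 : 0 ≤ P := intervalIntegral.integral_nonneg (h.strictMono.monotone hkl)
    fun t _ => flowForcing_nonneg hε x t
  -- C + 1 replaces C because C may vanish.
  have h3 : (C + 1)⁻¹ * dispersion (fun i => x i (σ k)) ≤ D + P := by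
    rw [inv_mul_le_iff₀ (by positivity)]
    linarith
  linarith

end IsFlow

end Window

/-! ### The drop-or-small dichotomy over a window. -/

section Convergence

/-- A nonnegative sequence cannot drop by γ forever, and once at most δ it stays so under either
alternative. -/
theorem eventually_le_of_dichotomy {s : ℕ → ℝ} {γ δ : ℝ} (hγ : 0 < γ) (h0 : ∀ j, 0 ≤ s j)
    (h : ∀ᶠ j in atTop, s (j + 1) ≤ s j - γ ∨ s (j + 1) ≤ δ) : ∀ᶠ j in atTop, s j ≤ δ := by
  obtain ⟨J, hJ⟩ := eventually_atTop.1 h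
  obtain ⟨j, hjJ, hj⟩ : ∃ j, J ≤ j ∧ s j ≤ δ := by
    by_contra! hcon
    have h1 : ∀ k : ℕ, s (J + k) ≤ s J - k * γ := by
      intro k
      induction k with
      | zero => simp
      | succ k ih =>
        rcases hJ (J + k) (by omega) with h2 | h2
        · push_cast
          rw [← add_assoc]
          linarith
        · exact absurd h2 (hcon _ (by omega)).not_ge
    obtain ⟨k, hk⟩ := exists_nat_gt (s J / γ)
    rw [div_lt_iff₀ hγ] at hk
    linarith [h1 k, h0 (J + k)]
  refine eventually_atTop.2 ⟨j, fun i hi => ?_⟩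
  induction i, hi using Nat.le_induction with
  | base => exact hj
  | succ i hi ih =>
    rcases hJ i (hjJ.trans hi) with h2 | h2
    · linarith
    · exact h2

variable {n : ℕ} {F : Type*} [NormedAddCommGroup F] [InnerProductSpace ℝ F]
  {dw η M : ℝ} {A : ℝ → Matrix (Fin n) (Fin n) ℝ} {σ : ℕ → ℝ} {K : Fin n → Set F}
  {g x : Fin n → ℝ → F} {R : ℝ}

/-- The factor 2μ/(1 + 2R) turns the forcing in the dispersion into 2μP, whose Q-part is Q/2: half
of the decrease of W absorbs it, and the remaining error is O(μ²). -/
theorem window_drop_aux {N M μ C Q P Sk Sl Wk Wl len : ℝ} (hN : 0 ≤ N) (hR0 : 0 ≤ R)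
    (hμ0 : 0 < μ) (hC0 : 0 < C) (hlen : len ≤ M)
    (hS : Sl ≤ (1 - C⁻¹) * Sk + (1 + 2 * R) * P)
    (hW : Wl - Wk ≤ 2 * R * N * μ ^ 2 * len - Q)
    (hP : P ≤ 2 * N * M * μ + (4 * μ)⁻¹ * Q) :
    Wl + 2 * μ / (1 + 2 * R) * Sl ≤ Wk + 2 * μ / (1 + 2 * R) * Sk
      - (Q / 2 + 2 * μ / (1 + 2 * R) * (C⁻¹ * Sk)) + ((4 + 2 * R) * N * M + 1) * μ ^ 2 := by
  have hR1 : 0 < 1 + 2 * R := by positivity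
  have h1 := mul_le_mul_of_nonneg_left hS (by positivity : 0 ≤ 2 * μ / (1 + 2 * R))
  have h2 := mul_le_mul_of_nonneg_left hP (by positivity : 0 ≤ 2 * μ)
  have h3 : 2 * μ / (1 + 2 * R) * ((1 - C⁻¹) * Sk + (1 + 2 * R) * P)
      = 2 * μ / (1 + 2 * R) * Sk - 2 * μ / (1 + 2 * R) * (C⁻¹ * Sk) + 2 * μ * P := by
    field_simp
  have h4 : 2 * μ * (2 * N * M * μ + (4 * μ)⁻¹ * Q) = 4 * N * M * μ ^ 2 + Q / 2 := by
    field_simp; ring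
  have h5 : 2 * R * N * μ ^ 2 * len ≤ 2 * R * N * μ ^ 2 * M :=
    mul_le_mul_of_nonneg_left hlen (by positivity)
  rw [h3] at h1
  rw [h4] at h2
  have h6 : 0 ≤ μ ^ 2 := by positivity
  have h7 : ((4 + 2 * R) * N * M + 1) * μ ^ 2
      = 4 * N * M * μ ^ 2 + 2 * R * N * μ ^ 2 * M + μ ^ 2 := by ring
  rw [h7]
  linarith

theorem dispersion_le_of_norm_le {y : Fin n → F} (hR0 : 0 ≤ R) (hy : ∀ i, ‖y i‖ ≤ R) :
    dispersion y ≤ 2 * n * R ^ 2 := by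
  have := dispersion_le_of_norm_sub_le (x := y) (δ := 2 * R) (by positivity) fun i j =>
    (norm_sub_le _ _).trans (by linarith [hy i, hy j])
  linarith

namespace IsFlow

/-- Young's inequality d ≤ μ + d²/(4μ), integrated, trades the first-order forcing for the
second-order dissipation of `sumSqDist`. -/
theorem integral_flowForcing_le (h : IsFlow dw A σ K g x) {a b ε μ : ℝ} (hμ : 0 < μ)
    (ha : 0 ≤ a) (hab : a ≤ b) :
    ∫ t in a..b, flowForcing K ε x t ≤ n * (μ + ε) * (b - a)
      + (4 * μ)⁻¹ * ∫ t in a..b, ∑ i, Metric.infDist (x i t) (K i) ^ 2 := by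
  have hQ : ContinuousOn (fun t => ∑ i, Metric.infDist (x i t) (K i) ^ 2) (Ici 0) :=
    continuousOn_finsetSum _ fun i _ => (h.continuousOn_infDist i).pow 2
  have hQi := hQ.intervalIntegrable_of_Ici a b ha (ha.trans hab)
  have hc : ∫ _ in a..b, (n : ℝ) * (μ + ε) = n * (μ + ε) * (b - a) := by
    rw [intervalIntegral.integral_const, smul_eq_mul, mul_comm]
  rw [← hc, ← intervalIntegral.integral_const_mul,
    ← intervalIntegral.integral_add intervalIntegrable_const (hQi.const_mul _)]
  refine intervalIntegral.integral_mono_on hab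
    ((h.continuousOn_flowForcing ε).intervalIntegrable_of_Ici a b ha (ha.trans hab))
    (intervalIntegrable_const.add (hQi.const_mul _)) fun t _ => ?_
  have h1 : (n : ℝ) * (μ + ε) = ∑ _i : Fin n, (μ + ε) := by simp [mul_add]
  rw [h1, Finset.mul_sum, ← Finset.sum_add_distrib]
  refine Finset.sum_le_sum fun i _ => ?_
  have h2 : 0 ≤ (4 * μ)⁻¹ * (Metric.infDist (x i t) (K i) - 2 * μ) ^ 2 := by positivity
  have h3 : (4 * μ)⁻¹ * (Metric.infDist (x i t) (K i) - 2 * μ) ^ 2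
      = (4 * μ)⁻¹ * Metric.infDist (x i t) (K i) ^ 2 - Metric.infDist (x i t) (K i) + μ := by
    field_simp; ring
  linarith

variable [CompleteSpace F]

/-- Over a strongly connected window with small perturbation, a combination of the distance to the
intersection and the dispersion either drops by a fixed amount or ends up small. -/
theorem exists_window_dichotomy [FiniteDimensional ℝ F] (h : IsFlow dw A σ K g x) (hη : 0 < η)
    (hM : 0 ≤ M) (hR0 : 0 ≤ R) (hR : ∀ i t, 0 ≤ t → ‖x i t‖ ≤ R) {z : F} (hz : z ∈ ⋂ i, K i)
    (hzR : ‖z‖ ≤ R) {δ : ℝ} (hδ : 0 < δ) :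
    ∃ c ≥ 0, ∃ γ > 0, ∃ ε > 0, ∀ k l, k < l → (∀ i t, σ k ≤ t → ‖g i t‖ ≤ ε) → σ l - σ k ≤ M →
      (∀ i j, i ≠ j → Relation.TransGen (fun i j => ∃ t ∈ Ico (σ k) (σ l), η ≤ A t j i) i j) →
      sumSqDist (⋂ i, K i) (fun i => x i (σ l)) + c * dispersion (fun i => x i (σ l))
          ≤ sumSqDist (⋂ i, K i) (fun i => x i (σ k)) + c * dispersion (fun i => x i (σ k)) - γ ∨
      sumSqDist (⋂ i, K i) (fun i => x i (σ l)) + c * dispersion (fun i => x i (σ l)) ≤ 2 * δ := by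
  obtain ⟨ρ, hρ, hρδ⟩ := exists_pos_sumSqDist_lt h.closed h.nonempty R hδ
  have hdw := h.dw_pos
  have hC := windowConst_nonneg n R dw η M
  set C := windowConst n R dw η M + 1 with hCdef
  have hC0 : 0 < C := by linarith
  set a := (4 + 2 * R) * n * M + 1 with ha
  have ha1 : 1 ≤ a := by
    have : 0 ≤ (4 + 2 * R) * n * M := by positivity
    linarith
  -- In the second alternative μL bounds dispersion plus squared distances at one time of the
  -- window, and μb bounds what is added to δ by its end.
  set L := a * (1 + 2 * R) * C + 2 * R * (2 * n * M + a) + 4 * a / dw with hL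
  have hL0 : 0 ≤ L := by positivity
  set b := a + 4 * n * R ^ 2 with hb
  have hb0 : 0 < b := by positivity
  obtain ⟨μ, hμ0, hμ1, hμL, hμb⟩ : ∃ μ > 0, μ ≤ 1 ∧ μ * L < ρ ∧ μ * b ≤ δ := by
    refine ⟨min 1 (min (ρ / (L + 1)) (δ / b)), by positivity, min_le_left _ _, ?_, ?_⟩
    · have h1 : min 1 (min (ρ / (L + 1)) (δ / b)) ≤ ρ / (L + 1) :=
        (min_le_right _ _).trans (min_le_left _ _)
      refine (mul_le_mul_of_nonneg_right h1 hL0).trans_lt ?_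
      rw [div_mul_eq_mul_div, div_lt_iff₀ (by positivity)]
      linarith
    · have h1 : min 1 (min (ρ / (L + 1)) (δ / b)) ≤ δ / b :=
        (min_le_right _ _).trans (min_le_right _ _)
      exact (le_div_iff₀ hb0).1 h1
  have hμ2 : μ ^ 2 ≤ μ := by nlinarith
  have hR1 : 0 < 1 + 2 * R := by positivity
  refine ⟨2 * μ / (1 + 2 * R), by positivity, a * μ ^ 2, by positivity, μ ^ 2, by positivity, ?_⟩
  intro k l hkl hg hlen hconn
  have hk0 := h.switch_nonneg k
  have hlt := h.strictMono hkl
  have hdwl : dw ≤ σ l - σ k := by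
    have h1 := h.mul_dwell_le hkl.le
    have h2 : (1 : ℝ) ≤ (l : ℝ) - k := by
      have : (k : ℝ) + 1 ≤ l := by exact_mod_cast hkl
      linarith
    nlinarith
  have hε0 : 0 ≤ μ ^ 2 := by positivity
  have hS := h.dispersion_contraction hη hR0 hR hk0 hε0 hg hkl.le le_rfl hlen hconn
  have hW := h.sumSqDist_sub_le hR0 hR hz hzR hk0 hg le_rfl hlt.le
  have hP := h.integral_flowForcing_le (ε := μ ^ 2) hμ0 hk0 hlt.le
  rw [← hCdef] at hS
  have hQc : ContinuousOn (fun t => ∑ i, Metric.infDist (x i t) (K i) ^ 2) (Ici 0) :=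
    continuousOn_finsetSum _ fun i _ => (h.continuousOn_infDist i).pow 2
  have hQ0 : ∀ t, 0 ≤ ∑ i, Metric.infDist (x i t) (K i) ^ 2 := fun t => by positivity
  -- At the minimizing time t the squared distances to the K i are at most their integral divided by
  -- the window's length, which is at least dw.
  obtain ⟨t, ht, htmin⟩ := isCompact_Icc.exists_isMinOn (nonempty_Icc.2 hlt.le)
    (hQc.mono fun t (ht : t ∈ Icc (σ k) (σ l)) => hk0.trans ht.1)
  have htQ : (σ l - σ k) * ∑ i, Metric.infDist (x i t) (K i) ^ 2
      ≤ ∫ t in σ k..σ l, ∑ i, Metric.infDist (x i t) (K i) ^ 2 := by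
    rw [← smul_eq_mul, ← intervalIntegral.integral_const]
    exact intervalIntegral.integral_mono_on hlt.le intervalIntegrable_const
      (hQc.intervalIntegrable_of_Ici _ _ hk0 (h.switch_nonneg l)) fun s hs => htmin hs
  have ht0 := hk0.trans ht.1
  have hSt := h.dispersion_sub_le hR0 hR hk0 hg le_rfl ht.1
  have hWt := h.sumSqDist_sub_le hR0 hR hz hzR hk0 hg ht.1 ht.2
  have hPt := integral_mono_interval_of_nonneg
    (h.continuousOn_flowForcing (μ ^ 2)).intervalIntegrable_of_Ici
    (flowForcing_nonneg hε0 x) hk0 le_rfl ht.1 ht.2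
  have hEt : 0 ≤ ∫ t in σ k..t, flowEnergy A x t :=
    intervalIntegral.integral_nonneg ht.1 fun s _ => h.flowEnergy_nonneg s
  have hQt : 0 ≤ ∫ s in t..σ l, ∑ i, Metric.infDist (x i s) (K i) ^ 2 :=
    intervalIntegral.integral_nonneg ht.2 fun s _ => hQ0 s
  have hSl := dispersion_le_of_norm_le (y := fun i => x i (σ l)) hR0
    fun i => hR i _ (h.switch_nonneg l)
  have hρt := hρδ (fun i => x i t) fun i => hR i t ht0
  have hSl0 := dispersion_nonneg fun i => x i (σ l)
  have hSk0 := dispersion_nonneg fun i => x i (σ k)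
  have hQk0 : 0 ≤ ∫ t in σ k..σ l, ∑ i, Metric.infDist (x i t) (K i) ^ 2 :=
    intervalIntegral.integral_nonneg hlt.le fun s _ => hQ0 s
  have hqt0 := hQ0 t
  generalize (∑ i, Metric.infDist (x i t) (K i) ^ 2) = qt at *
  generalize (∫ t in σ k..σ l, ∑ i, Metric.infDist (x i t) (K i) ^ 2) = Q at *
  generalize (∫ s in t..σ l, ∑ i, Metric.infDist (x i s) (K i) ^ 2) = Qt at *
  generalize (∫ t in σ k..σ l, flowForcing K (μ ^ 2) x t) = P at *
  generalize (∫ s in σ k..t, flowForcing K (μ ^ 2) x s) = Pt at *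
  generalize (∫ t in σ k..t, flowEnergy A x t) = Et at *
  generalize dispersion (fun i => x i (σ l)) = Sl at *
  generalize dispersion (fun i => x i (σ k)) = Sk at *
  generalize dispersion (fun i => x i t) = St at *
  generalize sumSqDist (⋂ i, K i) (fun i => x i (σ l)) = Wl at *
  generalize sumSqDist (⋂ i, K i) (fun i => x i (σ k)) = Wk at *
  generalize sumSqDist (⋂ i, K i) (fun i => x i t) = Wt at *
  have hn : (0 : ℝ) ≤ n := Nat.cast_nonneg n
  have hRn : 0 ≤ 2 * R * n * μ ^ 2 := by positivity
  -- the forcing over the window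
  have hP' : P ≤ 2 * n * M * μ + (4 * μ)⁻¹ * Q := by
    have h1 : n * (μ + μ ^ 2) * (σ l - σ k) ≤ n * (2 * μ) * M :=
      mul_le_mul (mul_le_mul_of_nonneg_left (by linarith) hn) hlen (by linarith) (by positivity)
    linarith
  have hdrop := window_drop_aux hn hR0 hμ0 hC0 hlen hS hW hP'
  rw [← ha] at hdrop
  -- A dissipation of at least 2aμ² beats the error aμ² and leaves the drop aμ². Otherwise Q is
  -- O(μ²) and Sk is O(μ), so compactness makes W < δ at time t, and W grows by only O(μ²)
  -- afterwards.
  rcases le_or_gt (2 * (a * μ ^ 2)) (Q / 2 + 2 * μ / (1 + 2 * R) * (C⁻¹ * Sk)) with hcase | hcase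
  · left
    linarith
  right
  have hterm : 0 ≤ 2 * μ / (1 + 2 * R) * (C⁻¹ * Sk) := by positivity
  have hQ4 : Q ≤ 4 * a * μ ^ 2 := by linarith
  have hSk : Sk ≤ a * (1 + 2 * R) * C * μ := by
    have h1 : 2 * μ / (1 + 2 * R) * (C⁻¹ * Sk) ≤ 2 * (a * μ ^ 2) := by linarith
    have h2 : 2 * μ / (1 + 2 * R) * (C⁻¹ * Sk) = 2 * μ * Sk / ((1 + 2 * R) * C) := by
      field_simp
    rw [h2, div_le_iff₀ (by positivity)] at h1
    have h3 : 2 * μ * Sk ≤ 2 * μ * (a * (1 + 2 * R) * C * μ) := by linarith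
    exact le_of_mul_le_mul_left h3 (by positivity)
  have hP2 : P ≤ (2 * n * M + a) * μ := by
    have h1 : (4 * μ)⁻¹ * Q ≤ (4 * μ)⁻¹ * (4 * a * μ ^ 2) :=
      mul_le_mul_of_nonneg_left hQ4 (by positivity)
    have h2 : (4 * μ)⁻¹ * (4 * a * μ ^ 2) = a * μ := by field_simp
    linarith
  have hqt : qt ≤ 4 * a / dw * μ := by
    rw [div_mul_eq_mul_div, le_div_iff₀ hdw]
    have h1 : qt * dw ≤ qt * (σ l - σ k) := mul_le_mul_of_nonneg_left hdwl hqt0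
    have h2 : 4 * a * μ ^ 2 ≤ 4 * a * μ := mul_le_mul_of_nonneg_left hμ2 (by positivity)
    linarith
  have hWt' : Wt < δ := by
    refine hρt (lt_of_le_of_lt ?_ hμL)
    have h1 : 2 * R * Pt ≤ 2 * R * ((2 * n * M + a) * μ) :=
      mul_le_mul_of_nonneg_left (hPt.trans hP2) (by positivity)
    rw [hL]
    linarith
  have hWl : Wl ≤ δ + a * μ := by
    have h1 : 2 * R * n * μ ^ 2 * (σ l - t) ≤ 2 * R * n * μ ^ 2 * M :=
      mul_le_mul_of_nonneg_left (by linarith [ht.1]) hRn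
    have h2 : 2 * R * n * M * μ ^ 2 ≤ 2 * R * n * M * μ :=
      mul_le_mul_of_nonneg_left hμ2 (by positivity)
    have h3 : 0 ≤ (4 * n * M + 1) * μ := by positivity
    rw [ha]
    linarith
  have hSl' : 2 * μ / (1 + 2 * R) * Sl ≤ 4 * n * R ^ 2 * μ := by
    have h1 : 2 * μ / (1 + 2 * R) ≤ 2 * μ := div_le_self (by positivity) (by linarith)
    have h2 := mul_le_mul h1 hSl hSl0 (by positivity)
    linarith
  rw [hb] at hμb
  linarith

end IsFlow

end Convergence

/-! ### Convergence of the perturbed flow. -/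

section Limits

theorem tendsto_zero_of_windows {φ : ℝ → ℝ} (h0 : ∀ t, 0 ≤ φ t) {τ : ℕ → ℝ}
    (hτ : Tendsto τ atTop atTop) (h1 : ∀ δ > 0, ∀ᶠ j in atTop, φ (τ j) ≤ δ)
    (h2 : ∀ δ > 0, ∀ᶠ j in atTop, ∀ t ∈ Ico (τ j) (τ (j + 1)), φ t ≤ φ (τ j) + δ) :
    Tendsto φ atTop (𝓝 0) := by
  refine tendsto_order.2 ⟨fun e he => Eventually.of_forall fun t => he.trans_le (h0 t),
    fun e he => ?_⟩
  obtain ⟨J, hJ⟩ := eventually_atTop.1 ((h1 (e / 3) (by positivity)).and (h2 (e / 3) (by positivity)))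
  filter_upwards [eventually_ge_atTop (τ J)] with t ht
  obtain ⟨j, hj, hjt⟩ := exists_mem_Ico_of_tendsto hτ ht
  obtain ⟨h3, h4⟩ := hJ j hj
  have := h4 t hjt
  linarith

variable {n : ℕ} {F : Type*} [NormedAddCommGroup F] [InnerProductSpace ℝ F]
  [FiniteDimensional ℝ F]
  {dw η M : ℝ} {A : ℝ → Matrix (Fin n) (Fin n) ℝ} {σ : ℕ → ℝ} {K : Fin n → Set F}
  {g x : Fin n → ℝ → F} {R : ℝ}

namespace IsFlow

theorem tendsto_sumSqDist (h : IsFlow dw A σ K g x) (hη : 0 < η)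
    (hM : 0 ≤ M) (hR0 : 0 ≤ R) (hR : ∀ i t, 0 ≤ t → ‖x i t‖ ≤ R)
    (hg : ∀ ε > 0, ∃ T, 0 ≤ T ∧ ∀ i t, T ≤ t → ‖g i t‖ ≤ ε) {κ : ℕ → ℕ} (hκ : StrictMono κ)
    (hgap : ∀ j, σ (κ (j + 1)) - σ (κ j) ≤ M)
    (hconn : ∀ j, ∀ p q, p ≠ q → Relation.TransGen
      (fun p q => ∃ t ∈ Ico (σ (κ j)) (σ (κ (j + 1))), η ≤ A t q p) p q) :
    Tendsto (fun t => sumSqDist (⋂ i, K i) fun i => x i t) atTop (𝓝 0) := by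
  have hcomplete : CompleteSpace F := FiniteDimensional.complete ℝ F
  obtain ⟨z, hz⟩ := h.nonempty
  obtain ⟨R', hR'0, hR', hzR'⟩ : ∃ R' ≥ 0, (∀ i t, 0 ≤ t → ‖x i t‖ ≤ R') ∧ ‖z‖ ≤ R' :=
    ⟨max R ‖z‖, hR0.trans (le_max_left _ _), fun i t ht => (hR i t ht).trans (le_max_left _ _),
      le_max_right _ _⟩
  have hτ : Tendsto (fun j => σ (κ j)) atTop atTop := h.tendsto_switch.comp hκ.tendsto_atTop
  refine tendsto_zero_of_windows (fun t => sumSqDist_nonneg _ _) hτ (fun δ hδ => ?_)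
    (fun δ hδ => ?_)
  · obtain ⟨c, hc, γ, hγ, ε, hε, hdich⟩ :=
      h.exists_window_dichotomy hη hM hR'0 hR' hz hzR' (half_pos hδ)
    obtain ⟨T, -, hT⟩ := hg ε hε
    have hev := eventually_le_of_dichotomy (δ := δ) (s := fun j =>
      sumSqDist (⋂ i, K i) (fun i => x i (σ (κ j))) + c * dispersion fun i => x i (σ (κ j))) hγ
      (fun j => add_nonneg (sumSqDist_nonneg _ _) (mul_nonneg hc (dispersion_nonneg _))) (by
        filter_upwards [hτ.eventually_ge_atTop T] with j hj
        have := hdich (κ j) (κ (j + 1)) (hκ j.lt_succ_self) (fun i t ht => hT i t (hj.trans ht))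
          (hgap j) (hconn j)
        rwa [mul_div_cancel₀ _ two_ne_zero] at this)
    filter_upwards [hev] with j hj
    have := mul_nonneg hc (dispersion_nonneg fun i => x i (σ (κ j)))
    linarith
  · set ε := δ / (2 * R' * n * M + 1) with hε
    have hden : 0 < 2 * R' * n * M + 1 := by positivity
    have hε0 : 0 < ε := by positivity
    have hεδ : 2 * R' * n * ε * M ≤ δ := by
      have : ε * (2 * R' * n * M + 1) = δ := div_mul_cancel₀ _ hden.ne'
      linarith
    obtain ⟨T, hT0, hT⟩ := hg ε hε0
    filter_upwards [hτ.eventually_ge_atTop T] with j hj t ht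
    have h1 := h.sumSqDist_sub_le hR'0 hR' hz hzR' hT0 hT hj ht.1
    have h2 : 0 ≤ ∫ t in σ (κ j)..t, ∑ i, Metric.infDist (x i t) (K i) ^ 2 :=
      intervalIntegral.integral_nonneg ht.1 fun s _ => by positivity
    have h3 : 2 * R' * n * ε * (t - σ (κ j)) ≤ 2 * R' * n * ε * M :=
      mul_le_mul_of_nonneg_left (by linarith [ht.2, hgap j]) (by positivity)
    linarith

theorem tendsto_dispersion (h : IsFlow dw A σ K g x) (hη : 0 < η)
    (hM : 0 ≤ M) (hR0 : 0 ≤ R) (hR : ∀ i t, 0 ≤ t → ‖x i t‖ ≤ R)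
    (hg : ∀ ε > 0, ∃ T, 0 ≤ T ∧ ∀ i t, T ≤ t → ‖g i t‖ ≤ ε) {κ : ℕ → ℕ} (hκ : StrictMono κ)
    (hgap : ∀ j, σ (κ (j + 1)) - σ (κ j) ≤ M)
    (hconn : ∀ j, ∀ p q, p ≠ q → Relation.TransGen
      (fun p q => ∃ t ∈ Ico (σ (κ j)) (σ (κ (j + 1))), η ≤ A t q p) p q) :
    Tendsto (fun t => dispersion fun i => x i t) atTop (𝓝 0) := by
  have hcomplete : CompleteSpace F := FiniteDimensional.complete ℝ F
  have hW := h.tendsto_sumSqDist hη hM hR0 hR hg hκ hgap hconn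
  have hτ : Tendsto (fun j => σ (κ j)) atTop atTop := h.tendsto_switch.comp hκ.tendsto_atTop
  -- The distance to K i is at most the distance to the intersection, already known to vanish, so
  -- the forcing integrated over a window becomes arbitrarily small.
  have hforce : ∀ ν > 0, ∃ ε ≥ 0, ∃ T, 0 ≤ T ∧ (∀ i t, T ≤ t → ‖g i t‖ ≤ ε) ∧
      ∀ a b, T ≤ a → a ≤ b → b - a ≤ M → ∫ t in a..b, flowForcing K ε x t ≤ ν := by
    intro ν hν
    set ε := ν / (2 * n * M + 1) with hε
    have hden : 0 < 2 * n * M + 1 := by positivity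
    have hε0 : 0 < ε := by positivity
    have hεν : 2 * n * M * ε ≤ ν := by
      have : ε * (2 * n * M + 1) = ν := div_mul_cancel₀ _ hden.ne'
      linarith
    obtain ⟨T₁, hT₁0, hT₁⟩ := hg ε hε0
    obtain ⟨T₂, hT₂⟩ := eventually_atTop.1 (hW.eventually_le_const (u := ε ^ 2 / 2) (by positivity))
    refine ⟨ε, hε0.le, max T₁ T₂, hT₁0.trans (le_max_left _ _),
      fun i t ht => hT₁ i t ((le_max_left _ _).trans ht), fun a b ha hab hM' => ?_⟩
    have ha0 : 0 ≤ a := hT₁0.trans ((le_max_left _ _).trans ha)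
    have h1 : ∀ t ∈ Icc a b, flowForcing K ε x t ≤ 2 * n * ε := by
      intro t ht
      have h2 : ∀ i ∈ Finset.univ, Metric.infDist (x i t) (K i) + ε ≤ 2 * ε := fun i _ => by
        have h3 := infDist_le_of_sumSqDist_le hε0.le
          (hT₂ t ((le_max_right _ _).trans (ha.trans ht.1))) i
        have h4 := Metric.infDist_le_infDist_of_subset (x := x i t) (iInter_subset K i) h.nonempty
        linarith
      refine (Finset.sum_le_sum h2).trans (le_of_eq ?_)
      rw [Finset.sum_const, Finset.card_univ, Fintype.card_fin, nsmul_eq_mul]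
      ring
    have h2 := intervalIntegral.integral_mono_on hab
      ((h.continuousOn_flowForcing ε).intervalIntegrable_of_Ici a b ha0 (ha0.trans hab))
      intervalIntegrable_const h1
    rw [intervalIntegral.integral_const, smul_eq_mul] at h2
    have h3 : (b - a) * (2 * n * ε) ≤ M * (2 * n * ε) :=
      mul_le_mul_of_nonneg_right hM' (by positivity)
    linarith
  refine tendsto_zero_of_windows (fun t => dispersion_nonneg _) hτ (fun δ hδ => ?_)
    (fun δ hδ => ?_)
  · have hC := windowConst_nonneg n R dw η M
    set c := (windowConst n R dw η M + 1)⁻¹ with hc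
    have hc0 : 0 < c := by positivity
    have hc1 : c ≤ 1 := inv_le_one_of_one_le₀ (by linarith)
    -- A dispersion of at least δ/2 contracts by cδ/2 and regains at most cδ/4; a smaller one ends
    -- below δ/2 + cδ/4 ≤ δ.
    obtain ⟨ε, hε, T, hT0, hT, hint⟩ := hforce (c * δ / 4 / (1 + 2 * R)) (by positivity)
    refine eventually_le_of_dichotomy (γ := c * δ / 4) (by positivity)
      (fun j => dispersion_nonneg _) ?_
    filter_upwards [hτ.eventually_ge_atTop T] with j hj
    have hle : κ j ≤ κ (j + 1) := (hκ j.lt_succ_self).le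
    have h1 := h.dispersion_contraction hη hR0 hR hT0 hε hT hle hj (hgap j) (hconn j)
    rw [← hc] at h1
    have h2 := hint _ _ hj (h.strictMono.monotone hle) (hgap j)
    rw [le_div_iff₀ (by positivity)] at h2
    have h0 := dispersion_nonneg fun i => x i (σ (κ j))
    rcases le_total (δ / 2) (dispersion fun i => x i (σ (κ j))) with h3 | h3
    · left
      have := mul_le_mul_of_nonneg_left h3 hc0.le
      linarith
    · right
      have := mul_nonneg hc0.le h0
      have : c * δ ≤ 1 * δ := mul_le_mul_of_nonneg_right hc1 hδ.le
      linarith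
  · obtain ⟨ε, hε, T, hT0, hT, hint⟩ := hforce (δ / (2 * R + 1)) (by positivity)
    filter_upwards [hτ.eventually_ge_atTop T] with j hj t ht
    have h1 := h.dispersion_sub_le hR0 hR hT0 hT hj ht.1
    have h2 := hint _ _ hj ht.1 (by linarith [ht.2, hgap j])
    have h3 : 0 ≤ ∫ s in σ (κ j)..t, flowEnergy A x s :=
      intervalIntegral.integral_nonneg ht.1 fun s _ => h.flowEnergy_nonneg s
    have h4 : 0 ≤ ∫ s in σ (κ j)..t, flowForcing K ε x s :=
      intervalIntegral.integral_nonneg ht.1 fun s _ => flowForcing_nonneg hε x s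
    rw [le_div_iff₀ (by positivity)] at h2
    linarith

end IsFlow

end Limits

/-! ### The closed loop: gains, boundedness, vanishing gradient terms. -/

section ClosedLoop

variable {n m : ℕ} {η : ℝ}

theorem CommGraph.weight_nonneg (hη : 0 < η) (G : CommGraph n η) (i j : Fin n) : 0 ≤ G.A i j := by
  by_cases h : G.toDigraph.Adj j i
  · exact hη.le.trans (G.le_weight i j h)
  · exact (G.weight_eq_zero i j h).ge

theorem CommGraph.sum_neighbors (G : CommGraph n η) {F : Type*} [NormedAddCommGroup F]
    [NormedSpace ℝ F] (y : Fin n → F) (i : Fin n) :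
    ∑ j ∈ G.neighbors i, G.A i j • (y j - y i) = -∑ j, G.A i j • (y i - y j) := by
  rw [← Finset.sum_neg_distrib, neighbors, Finset.sum_filter]
  refine Finset.sum_congr rfl fun j _ => ?_
  split_ifs with h
  · rw [← smul_neg, neg_sub]
  · rw [G.weight_eq_zero i j h, zero_smul, neg_zero]

variable {G : ℝ → CommGraph n η} {σ : ℕ → ℝ} {f : Fin n → EuclideanSpace ℝ (Fin m) → ℝ}
  {H : Fin n → Set (EuclideanSpace ℝ (Fin m))} {x : Fin n → ℝ → EuclideanSpace ℝ (Fin m)}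
  {q : Fin n → ℝ → ℝ} {dw : ℝ}

namespace IsSolution

theorem isFlow (hsol : IsSolution G σ f H x q) (hη : 0 < η) (hdw : 0 < dw)
    (hH_closed : ∀ i, IsClosed (H i)) (hH_conv : ∀ i, Convex ℝ (H i))
    (hH_ne : (⋂ i, H i).Nonempty) (hG_bal : ∀ t, 0 ≤ t → (G t).Balanced)
    (hG_switch : IsSwitchingSeq G dw σ) :
    IsFlow dw (fun t => (G t).A) σ H (fun i t => (1 / √(q i t)) • gradient (f i) (x i t)) x where
  dw_pos := hdw
  zero := hG_switch.zero
  dwell := hG_switch.dwell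
  const k t ht := by rw [hG_switch.const k t ht]
  weight_nonneg t := (G t).weight_nonneg hη
  balanced := hG_bal
  closed := hH_closed
  convex := hH_conv
  nonempty := hH_ne
  cont := hsol.x_cont
  deriv i k t ht := by
    have := hsol.x_deriv i k t ht
    rwa [(G t).sum_neighbors (fun j => x j t) i] at this

theorem state_bounds (hsol : IsSolution G σ f H x q) (i : Fin n) {t : ℝ} (ht : 0 ≤ t) :
    q i 0 + Real.pi / 4 * t ≤ q i t ∧ q i t ≤ q i 0 + Real.pi / 2 * t := by
  have hc : ContinuousOn (q i) (Icc 0 t) := fun s hs =>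
    ((hsol.q_deriv i s hs.1).continuousWithinAt).mono fun u hu => hu.1
  have hd : ∀ s ∈ Ioo 0 t,
      HasDerivWithinAt (q i) (Real.arctan (Real.exp ‖x i s‖)) (Ioi s) s := fun s hs =>
    (hsol.q_deriv i s hs.1.le).mono fun u hu => hs.1.le.trans (le_of_lt hu)
  have h1 := intervalIntegral.integral_le_sub_of_hasDeriv_right_of_le ht hc hd
    (φ := fun _ => Real.pi / 4) (by simp) fun s _ => by
      rw [← Real.arctan_one]
      exact Real.arctan_mono (Real.one_le_exp (norm_nonneg _))
  have h2 := intervalIntegral.sub_le_integral_of_hasDeriv_right_of_le ht hc hd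
    (φ := fun _ => Real.pi / 2) (by simp) fun s _ => (Real.arctan_lt_pi_div_two _).le
  rw [intervalIntegral.integral_const, smul_eq_mul] at h1 h2
  constructor <;> linarith

theorem state_pos (hsol : IsSolution G σ f H x q) (i : Fin n) {t : ℝ} (ht : 0 ≤ t) :
    0 < q i t := by
  have := hsol.q_init i
  have := (hsol.state_bounds i ht).1
  have := mul_nonneg (by positivity : 0 ≤ Real.pi / 4) ht
  linarith

/-- The gains of the gradient terms of different agents stay comparable. -/
theorem exists_gain_ratio (hsol : IsSolution G σ f H x q) :
    ∃ ρ ≥ 0, ∀ i j t, 0 ≤ t → 1 / √(q j t) ≤ ρ * (1 / √(q i t)) := by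
  -- C compares the initial values, and 2 is the ratio of the extreme growth rates π/2 and π/4.
  obtain ⟨C, hC⟩ := (Set.finite_range fun p : Fin n × Fin n => q p.1 0 / q p.2 0).bddAbove
  have hC' : ∀ i j, q i 0 ≤ max C 2 * q j 0 := fun i j => by
    rw [← div_le_iff₀ (hsol.q_init j)]
    exact (hC (mem_range_self (i, j))).trans (le_max_left _ _)
  refine ⟨√(max C 2), Real.sqrt_nonneg _, fun i j t ht => ?_⟩
  have hi := hsol.state_pos i ht
  have hj := hsol.state_pos j ht
  rw [mul_one_div, div_le_div_iff₀ (Real.sqrt_pos.2 hj) (Real.sqrt_pos.2 hi), one_mul,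
    ← Real.sqrt_mul (by positivity)]
  refine Real.sqrt_le_sqrt ?_
  have h1 := (hsol.state_bounds i ht).2
  have h2 := mul_le_mul_of_nonneg_left (hsol.state_bounds j ht).1
    (by positivity : 0 ≤ max C 2)
  have h3 : 2 * (Real.pi / 4 * t) ≤ max C 2 * (Real.pi / 4 * t) :=
    mul_le_mul_of_nonneg_right (le_max_right _ _) (by positivity)
  linarith [hC' i j]

theorem exists_norm_le (hsol : IsSolution G σ f H x q) (hη : 0 < η) (hdw : 0 < dw)
    (hf_diff : ∀ i, Differentiable ℝ (f i)) (hf_conv : ∀ i, ConvexOn ℝ Set.univ (f i))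
    (hX_ne : ∀ i, {s | gradient (f i) s = 0}.Nonempty)
    (hX_bdd : ∀ i, Bornology.IsBounded {s | gradient (f i) s = 0})
    (hH_closed : ∀ i, IsClosed (H i)) (hH_conv : ∀ i, Convex ℝ (H i))
    (hH_ne : (⋂ i, H i).Nonempty) (hG_bal : ∀ t, 0 ≤ t → (G t).Balanced)
    (hG_switch : IsSwitchingSeq G dw σ) :
    ∃ R : ℝ, ∀ i, ∀ t, 0 ≤ t → ‖x i t‖ ≤ R := by
  have hflow := hsol.isFlow hη hdw hH_closed hH_conv hH_ne hG_bal hG_switch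
  obtain ⟨z, hz⟩ := hH_ne
  obtain ⟨ρ, hρ0, hρ⟩ := hsol.exists_gain_ratio
  choose y hy using hX_ne
  obtain ⟨β₀, hβ₀⟩ := (Set.finite_range fun i => f i z - f i (y i)).bddAbove
  set β := max β₀ 0
  have hβ0 : 0 ≤ β := le_max_right _ _
  have hβ : ∀ i s, f i z - β ≤ f i s := fun i s => by
    have h1 := (hf_conv i).le_of_gradient_eq_zero (hf_diff i) (hy i) s
    have h2 : f i z - f i (y i) ≤ β := (hβ₀ (mem_range_self i)).trans (le_max_left _ _)
    linarith
  -- No f j falls below f j z by more than β, so all agents together lose at most nρβ times the gain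
  -- of agent i. Beyond this level the gain from agent i alone compensates.
  choose r hr using fun i => (hf_conv i).exists_forall_norm_le (hf_diff i) ⟨y i, hy i⟩ (hX_bdd i)
    (f i z + ρ * n * β)
  obtain ⟨r₀, hr₀⟩ := (Set.finite_range r).bddAbove
  have hfar : ∀ i s, max r₀ 0 < ‖s‖ → f i z + ρ * n * β < f i s := fun i s hs => by
    by_contra! h
    exact ((hr i s h).trans ((hr₀ (mem_range_self i)).trans (le_max_left _ _))).not_gt hs
  set φ : ℝ → ℝ := fun t => ∑ i, ‖x i t - z‖ ^ 2 / 2 with hφ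
  set B := max (φ 0) (n * ((max r₀ 0 + ‖z‖) ^ 2 / 2)) with hB
  have hbound : ∀ t, 0 ≤ t → φ t ≤ B := by
    intro t ht
    refine le_of_piecewise_deriv_nonpos hflow.zero hflow.tendsto_switch
      (continuousOn_finsetSum _ fun i _ =>
        (((hflow.cont i).sub continuousOn_const).norm.pow 2).div_const 2)
      (le_max_left _ _)
      (fun k s hs => hasDerivAt_sum_norm_sub_sq (fun i => hflow.deriv i k s hs) fun _ => z)
      (fun k s hs hBs => ?_) ht
    have hs0 : 0 ≤ s := (hflow.switch_nonneg k).trans hs.1.le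
    rw [sum_inner_velocity, lapForm_sub_const (hflow.balanced s hs0)]
    have h1 := dirichletEnergy_nonneg (hflow.weight_nonneg s) fun i => x i s
    have h2 : 0 ≤ ∑ i, inner ℝ (x i s - z) (x i s - proj (H i) (x i s)) :=
      Finset.sum_nonneg fun i _ => (sq_nonneg _).trans
        (norm_sub_proj_sq_le_inner (hflow.set_nonempty i) (hH_closed i) (hH_conv i) _
          (mem_iInter.1 hz i))
    -- B is chosen so that exceeding it forces some agent outside the radius where its objective is
    -- below the threshold.
    obtain ⟨i, hi⟩ : ∃ i, max r₀ 0 + ‖z‖ < ‖x i s - z‖ := by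
      by_contra! hcon
      have h3 : φ s ≤ ∑ _i : Fin n, (max r₀ 0 + ‖z‖) ^ 2 / 2 :=
        Finset.sum_le_sum fun i _ =>
          div_le_div_of_nonneg_right (pow_le_pow_left₀ (norm_nonneg _) (hcon i) 2) two_pos.le
      rw [Finset.sum_const, Finset.card_univ, Fintype.card_fin, nsmul_eq_mul] at h3
      exact (h3.trans (le_max_right _ _)).not_gt hBs
    have hfi := hfar i (x i s) (by linarith [norm_sub_le (x i s) z])
    have hw0 : ∀ j, 0 ≤ 1 / √(q j s) := fun j => by positivity
    have h3 : ∑ j, (1 / √(q j s) * (f j (x j s) - f j z + β) - 1 / √(q j s) * β)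
        ≤ ∑ j, inner ℝ (x j s - z) ((1 / √(q j s)) • gradient (f j) (x j s)) := by
      refine Finset.sum_le_sum fun j _ => ?_
      rw [inner_smul_right, ← mul_sub]
      refine mul_le_mul_of_nonneg_left ?_ (hw0 j)
      have := (hf_conv j).add_inner_gradient_le (hf_diff j) (x j s) z
      rw [← neg_sub (x j s) z, inner_neg_right, real_inner_comm] at this
      linarith
    have h4 : 1 / √(q i s) * (f i (x i s) - f i z + β)
        ≤ ∑ j, 1 / √(q j s) * (f j (x j s) - f j z + β) :=
      Finset.single_le_sum (f := fun j => 1 / √(q j s) * (f j (x j s) - f j z + β))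
        (fun j _ => mul_nonneg (hw0 j) (by linarith [hβ j (x j s)])) (Finset.mem_univ i)
    have h5 : ∑ j, 1 / √(q j s) * β ≤ ∑ _j : Fin n, ρ * (1 / √(q i s)) * β :=
      Finset.sum_le_sum fun j _ => mul_le_mul_of_nonneg_right (hρ i j s hs0) hβ0
    have h6 : 1 / √(q i s) * (ρ * n * β) ≤ 1 / √(q i s) * (f i (x i s) - f i z + β) :=
      mul_le_mul_of_nonneg_left (by linarith) (hw0 i)
    rw [Finset.sum_const, Finset.card_univ, Fintype.card_fin, nsmul_eq_mul] at h5
    rw [Finset.sum_sub_distrib] at h3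
    linarith
  refine ⟨√(2 * B) + ‖z‖, fun i t ht => ?_⟩
  have h1 : ‖x i t - z‖ ^ 2 / 2 ≤ φ t :=
    Finset.single_le_sum (f := fun i => ‖x i t - z‖ ^ 2 / 2) (fun _ _ => by positivity)
      (Finset.mem_univ i)
  have h2 : ‖x i t - z‖ ≤ √(2 * B) := Real.le_sqrt_of_sq_le (by linarith [hbound t ht])
  linarith [norm_sub_norm_le (x i t) z]

/-- Along bounded solutions the gradient terms vanish asymptotically. -/
theorem exists_norm_gradient_term_le (hsol : IsSolution G σ f H x q)
    (hf_diff : ∀ i, Differentiable ℝ (f i)) (hf_conv : ∀ i, ConvexOn ℝ Set.univ (f i))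
    {R : ℝ} (hR : ∀ i, ∀ t, 0 ≤ t → ‖x i t‖ ≤ R) {ε : ℝ} (hε : 0 < ε) :
    ∃ T, 0 ≤ T ∧ ∀ i t, T ≤ t → ‖(1 / √(q i t)) • gradient (f i) (x i t)‖ ≤ ε := by
  choose c hc using fun i => (hf_conv i).exists_norm_gradient_le (hf_diff i) R
  obtain ⟨C, hC⟩ := (Set.finite_range c).bddAbove
  -- From q i t ≥ (π/4)t ≥ t/2, this T gives √(q i t) ≥ C/ε.
  refine ⟨2 * (C / ε) ^ 2, by positivity, fun i t ht => ?_⟩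
  have ht0 : 0 ≤ t := le_trans (by positivity) ht
  have hq := hsol.state_pos i ht0
  have h1 : C / ε ≤ √(q i t) := by
    refine Real.le_sqrt_of_sq_le ?_
    have h2 := (hsol.state_bounds i ht0).1
    have h3 : 1 / 2 * t ≤ Real.pi / 4 * t :=
      mul_le_mul_of_nonneg_right (by linarith [Real.pi_gt_three]) ht0
    linarith [hsol.q_init i]
  rw [norm_smul, Real.norm_of_nonneg (by positivity), one_div, inv_mul_le_iff₀ (Real.sqrt_pos.2 hq)]
  exact ((hc i _ (hR i t ht0)).trans (hC (mem_range_self i))).trans ((div_le_iff₀ hε).1 h1)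

end IsSolution

end ClosedLoop

theorem mainTheorem1 {n m : ℕ}
    -- differentiable convex objectives, each with a nonempty bounded set of critical points
    (f : Fin n → EuclideanSpace ℝ (Fin m) → ℝ)
    (hf_diff : ∀ i, Differentiable ℝ (f i))
    (hf_conv : ∀ i, ConvexOn ℝ Set.univ (f i))
    (hX_ne : ∀ i, {s | gradient (f i) s = 0}.Nonempty)
    (hX_bdd : ∀ i, Bornology.IsBounded {s | gradient (f i) s = 0})
    -- closed convex constraint sets with a common point
    (H : Fin n → Set (EuclideanSpace ℝ (Fin m)))
    (hH_closed : ∀ i, IsClosed (H i))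
    (hH_conv : ∀ i, Convex ℝ (H i))
    (hH_ne : (⋂ i, H i).Nonempty)
    -- balanced switching graphs, jointly strongly connected, with a dwell time
    {η dw M : ℝ} (hη : 0 < η) (hdw : 0 < dw) (hM : dw < M)
    (G : ℝ → CommGraph n η) (σ : ℕ → ℝ)
    (hG_bal : ∀ t, 0 ≤ t → (G t).Balanced)
    (hG_switch : IsSwitchingSeq G dw σ)
    (hG_conn : JointlyStronglyConnected G σ M)
    -- an arbitrary trajectory of the algorithm
    (x : Fin n → ℝ → EuclideanSpace ℝ (Fin m)) (q : Fin n → ℝ → ℝ)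
    (hsol : IsSolution G σ f H x q) :
    (∃ R : ℝ, ∀ i, ∀ t, 0 ≤ t → ‖x i t‖ ≤ R) ∧
    Tendsto (fun t => ‖avg x t - proj (⋂ i, H i) (avg x t)‖) atTop (𝓝 0) ∧
    ∀ i, Tendsto (fun t => x i t - avg x t) atTop (𝓝 0) := by
  have hflow := hsol.isFlow hη hdw hH_closed hH_conv hH_ne hG_bal hG_switch
  obtain ⟨R, hR⟩ := hsol.exists_norm_le hη hdw hf_diff hf_conv hX_ne hX_bdd hH_closed hH_conv hH_ne
    hG_bal hG_switch
  refine ⟨⟨R, hR⟩, ?_⟩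
  obtain ⟨κ, hκ, -, hκ'⟩ := hG_conn
  have hconn : ∀ j, ∀ p r, p ≠ r → Relation.TransGen
      (fun p r => ∃ t ∈ Ico (σ (κ j)) (σ (κ (j + 1))), η ≤ (G t).A r p) p r := fun j p r hpr =>
    Relation.TransGen.mono (fun u v ⟨t, ht, h⟩ => ⟨t, ht, (G t).le_weight v u h⟩) _ _
      ((hκ' j).2 p r hpr)
  have hR' : ∀ i t, 0 ≤ t → ‖x i t‖ ≤ max R 0 := fun i t ht => (hR i t ht).trans (le_max_left _ _)
  have hM0 : 0 ≤ M := (hdw.trans hM).le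
  have hg := fun ε hε => hsol.exists_norm_gradient_term_le hf_diff hf_conv hR (ε := ε) hε
  have hW := hflow.tendsto_sumSqDist hη hM0 (le_max_right R 0) hR' hg hκ (fun j => (hκ' j).1) hconn
  have hS := hflow.tendsto_dispersion hη hM0 (le_max_right R 0) hR' hg hκ (fun j => (hκ' j).1) hconn
  refine ⟨?_, tendsto_sub_mean hS⟩
  simp only [norm_sub_proj_eq_infDist hH_ne (isClosed_iInter hH_closed) (convex_iInter hH_conv)]
  -- Without agents the intersection is the whole space and the distance is 0.
  rcases isEmpty_or_nonempty (Fin n) with hn | hn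
  · simp [Metric.infDist_zero_of_mem (mem_univ _)]
  · exact tendsto_infDist_mean hW hS
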